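/- Write points of $\mathbb R^2$ as $(t,x)$. Let $\Omega\subseteq\mathbb R^2$ be open and $x$-simple, i.e. for every $t_0\in\mathbb R$ the slice $\{x\mid (t_0,x)\in\Omega\}$ is an open interval (possibly unbounded) or empty. For $q\in\{0,\infty\}$, a distribution $u\in\mathcal D'(\Omega)$ is called ${\rm C}^q$-semiregular in $t$ if for all open intervals $I,J$ with $I\times J\subseteq\Omega$ the restriction of $u$ to $I\times J$ belongs to ${\rm C}^q(I,\mathcal D'(J))$, that is, there is a ${\rm C}^q$-curve $U\colon I\to\mathcal D'(J)$ such that $\langle u,\varphi\rangle=\int_I\langle U(t),\varphi(t,\cdot)\rangle\,{\rm d}t$ for all $\varphi\in\mathcal D(I\times J)$. A vector distribution $v\in\mathcal D'(\Omega,\mathbb R^p)=\mathcal D'(\Omega)^p$ is ${\rm C}^q$-semiregular in $t$ if all its components are. By ${\rm C}^p_x(\Omega)$ we denote the space of continuous functions on $\Omega$ that admit derivatives with respect to $x$ up to order $p$, all of which are continuous on $\Omega$. For a locally integrable function $\psi$ on $\Omega$, $T_\psi$ denotes the associated regular distribution. (1) (Systems.) Let $A\in{\rm C}^\infty(\Omega,\mathrm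 M_p(\mathbb R))$ and let $F\in{\rm C}(\Omega,\mathbb R^p)$ (resp. $F\in{\rm C}^\infty(\Omega,\mathbb R^p)$). If $v\in\mathcal D'(\Omega,\mathbb R^p)$ satisfies $v_x=Av+T_F$ in the sense of distributions and is ${\rm C}^0$-semiregular (resp. ${\rm C}^\infty$-semiregular) in $t$, then $v=T_\psi$ for some classical solution $\psi$ of the system, i.e. $\psi\in{\rm C}^1_x(\Omega,\mathbb R^p)$ and $\psi_x=A\psi+F$ on $\Omega$ (resp. for some such solution $\psi\in{\rm C}^\infty(\Omega,\mathbb R^p)$). (2) (Scalar equations.) Let $P=\sum_{k=0}^p g_k(t,x)\,\partial_x^k$ with $g_0,\dots,g_p\in{\rm C}^\infty(\Omega)$ and $g_p\neq0$ everywhere on $\Omega$, and let $f\in{\rm C}(\Omega)$ (resp. $f\in{\rm C}^\infty(\Omega)$). If $u\in\mathcal D'(\Omega)$ satisfies $Pu=T_f$ in the sense of distributions and is ${\rm C}^0$-semiregular (resp. ${\rm C}^\infty$-semiregular) in $t$, then $u=T_\psi$ for some classical solution $\psi$ of the equation, i.e. $\psi\in{\rm C}^p_x(\Omega)$ and $P\psi=f$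 on $\Omega$ (resp. for some such solution $\psi\in{\rm C}^\infty(\Omega)$). -/

import Mathlib

open Set Filter Topology TopologicalSpace MeasureTheory
open scoped ContDiff Distributions CompactConvergenceCLM LineDeriv Matrix

namespace ParamODE

/-! ### Sets that are simple with respect to `x`

Points of the `(t, x)`-plane are pairs `z : ℝ × ℝ` with `z.1 = t` and `z.2 = x`. -/

/-- A subset of the `(t, x)`-plane is `x`-simple if its intersection with every line `t = const`
is an open interval (bounded or not) or empty. -/
def IsXSimple (U : Set (ℝ × ℝ)) : Prop :=
  ∀ t : ℝ, IsOpen {x : ℝ | (t, x) ∈ U} ∧ OrdConnected {x : ℝ | (t, x) ∈ U}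

/-! ### Functions that are continuously differentiable in `x` -/

/-- The `k`-th partial derivative with respect to `x` of a function of `(t, x)`. -/
noncomputable def xDeriv {G : Type*} [NormedAddCommGroup G] [NormedSpace ℝ G]
    (k : ℕ) (ψ : ℝ × ℝ → G) (z : ℝ × ℝ) : G :=
  iteratedDeriv k (fun x => ψ (z.1, x)) z.2

/-- The space `C^p_x(Ω)`: continuous functions on `Ω` that admit derivatives with respect to `x`
up to order `p`, all of them continuous (jointly in `(t, x)`) on `Ω`. -/
def IsCx {G : Type*} [NormedAddCommGroup G] [NormedSpace ℝ G]
    (p : ℕ) (Ω : Set (ℝ × ℝ)) (ψ : ℝ × ℝ → G) : Prop :=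
  (∀ k < p, ∀ z ∈ Ω, DifferentiableAt ℝ (iteratedDeriv k (fun x => ψ (z.1, x))) z.2) ∧
  ∀ k ≤ p, ContinuousOn (xDeriv k ψ) Ω

/-! ### Operations on distributions -/

section Distr

variable {E : Type*} [NormedAddCommGroup E] [NormedSpace ℝ E]

/-- The regular distribution `T_f : φ ↦ ∫ φ f` associated with a function `f` that is locally
integrable on `Ω`. -/
noncomputable def regularDistr [MeasureSpace E] [OpensMeasurableSpace E]
    (Ω : Opens E) (f : E → ℝ) : 𝓓'(Ω, ℝ) :=
  (TestFunction.integralAgainstBilinCLM (ContinuousLinearMap.lsmul ℝ ℝ) volume f :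
    𝓓(Ω, ℝ) →L[ℝ] ℝ)

/-- Restriction of a distribution on `Ω` to an open subset `Ω'`
(test functions on `Ω'` are extended by zero). -/
noncomputable def restrictDistr {Ω Ω' : Opens E} (_h : Ω' ≤ Ω) (u : 𝓓'(Ω, ℝ)) : 𝓓'(Ω', ℝ) :=
  (TestFunction.monoCLM ℝ : 𝓓(Ω', ℝ) →L[ℝ] 𝓓(Ω, ℝ)).precompCompactConvergenceCLM ℝ u

/-- A smooth function on `Ω` agrees on each compact subset with a globally smooth function. -/
theorem exists_contDiff_eqOn [FiniteDimensional ℝ E] {Ω : Opens E} {a : E → ℝ}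
    (ha : ContDiffOn ℝ ∞ a Ω) {K : Compacts E} (hK : (K : Set E) ⊆ Ω) :
    ∃ g : E → ℝ, ContDiff ℝ ∞ g ∧ EqOn g a K := by
  obtain ⟨f, hf0, hf1, -⟩ :=
    exists_contMDiffMap_zero_one_nhds_of_isClosed (n := (⊤ : ℕ∞)) (modelWithCornersSelf ℝ E)
      (s := (Ω : Set E)ᶜ) (t := (K : Set E)) Ω.isOpen.isClosed_compl
      K.isCompact.isClosed (disjoint_compl_left_iff_subset.2 hK)
  have hf : ContDiff ℝ ∞ f := f.contMDiff.contDiff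
  refine ⟨fun x => f x * a x, contDiff_iff_contDiffAt.2 fun x => ?_, fun x hx => ?_⟩
  · by_cases hx : x ∈ (Ω : Set E)
    · exact hf.contDiffAt.mul (ha.contDiffAt (Ω.isOpen.mem_nhds hx))
    · have h0 : ∀ᶠ y in 𝓝 x, f y = 0 := (eventually_nhdsSet_iff_forall.1 hf0) x hx
      refine (contDiffAt_const (c := (0 : ℝ))).congr_of_eventuallyEq ?_
      filter_upwards [h0] with y hy
      simp [hy]
  · have h1 : f x = 1 := (eventually_nhdsSet_iff_forall.1 hf1 x hx).self_of_nhds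
    simp [h1]

/-- The product `a φ` of a smooth function `a` on `Ω` and a test function `φ` on `Ω`. -/
noncomputable def mulTest [FiniteDimensional ℝ E] {Ω : Opens E} {a : E → ℝ}
    (ha : ContDiffOn ℝ ∞ a Ω) (φ : 𝓓(Ω, ℝ)) : 𝓓(Ω, ℝ) where
  toFun z := φ z * a z
  contDiff' := by
    obtain ⟨g, hg, hga⟩ := exists_contDiff_eqOn ha
      (K := ⟨tsupport φ, φ.hasCompactSupport⟩) φ.tsupport_subset
    have h : (fun z => φ z * a z) = fun z => φ z * g z := by
      funext z
      by_cases hz : z ∈ tsupport φ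
      · rw [hga hz]
      · simp [image_eq_zero_of_notMem_tsupport hz]
    rw [h]
    exact φ.contDiff.mul hg
  hasCompactSupport' := φ.hasCompactSupport.mul_right
  tsupport_subset' := (tsupport_mul_subset_left).trans φ.tsupport_subset

/-- Multiplication of test functions by a smooth function, as a continuous linear map. -/
noncomputable def mulTestCLM [FiniteDimensional ℝ E] {Ω : Opens E} {a : E → ℝ}
    (ha : ContDiffOn ℝ ∞ a Ω) : 𝓓(Ω, ℝ) →L[ℝ] 𝓓(Ω, ℝ) :=
  TestFunction.limitCLM ℝ (mulTest ha)
    (fun _ hK => TestFunction.ofSupportedInCLM ℝ hK ∘L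
      ContDiffMapSupportedIn.bilinLeftCLM (ContinuousLinearMap.mul ℝ ℝ)
        (exists_contDiff_eqOn ha hK).choose_spec.1)
    (fun K hK f => by
      ext z
      change f z * a z = f z * (exists_contDiff_eqOn ha hK).choose z
      by_cases hz : z ∈ (K : Set E)
      · rw [(exists_contDiff_eqOn ha hK).choose_spec.2 hz]
      · have h0 : f z = 0 := f.zero_on_compl hz
        rw [h0, zero_mul, zero_mul])

/-- The product `a u` of a smooth function `a` on `Ω` and a distribution `u` on `Ω`:
`⟨a u, φ⟩ = ⟨u, a φ⟩`. -/
noncomputable def mulDistr [FiniteDimensional ℝ E] {Ω : Opens E} {a : E → ℝ}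
    (ha : ContDiffOn ℝ ∞ a Ω) (u : 𝓓'(Ω, ℝ)) : 𝓓'(Ω, ℝ) :=
  (mulTestCLM ha).precompCompactConvergenceCLM ℝ u

end Distr

/-- The distributional derivative with respect to `x`. -/
noncomputable def xDerivDistr {Ω : Opens (ℝ × ℝ)} (u : 𝓓'(Ω, ℝ)) : 𝓓'(Ω, ℝ) :=
  ∂_{((0, 1) : ℝ × ℝ)} u

/-! ### Semiregularity in `t` -/

/-- `U` is a curve of class `C^q` on the open set `I ⊆ ℝ`, with values in a topological vector
space: `D k` is the `k`-th derivative of `U`, the limit of difference quotients in the topology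
of `G`. -/
def IsCurveOfClass {G : Type*} [AddCommGroup G] [Module ℝ G] [TopologicalSpace G]
    (q : ℕ∞) (I : Set ℝ) (U : ℝ → G) : Prop :=
  ∃ D : ℕ → ℝ → G, D 0 = U ∧
    (∀ k : ℕ, (k : ℕ∞) ≤ q → ContinuousOn (D k) I) ∧
    ∀ k : ℕ, (k : ℕ∞) < q → ∀ t ∈ I, Tendsto (slope (D k) t) (𝓝[≠] t) (𝓝 (D (k + 1) t))

/-- The open rectangle `I × J`. -/
def rect (I J : Opens ℝ) : Opens (ℝ × ℝ) :=
  ⟨(I : Set ℝ) ×ˢ (J : Set ℝ), I.isOpen.prod J.isOpen⟩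

/-- The slice `φ(t, ·)` of a test function on `I × J`, a test function on `J`. -/
noncomputable def sliceTest {I J : Opens ℝ} (φ : 𝓓(rect I J, ℝ)) (t : ℝ) : 𝓓(J, ℝ) where
  toFun x := φ (t, x)
  contDiff' := φ.contDiff.comp (contDiff_const.prodMk contDiff_id)
  hasCompactSupport' :=
    HasCompactSupport.intro (K := Prod.snd '' tsupport φ)
      (φ.hasCompactSupport.isCompact.image continuous_snd) fun x hx =>
        image_eq_zero_of_notMem_tsupport fun h => hx ⟨(t, x), h, rfl⟩
  tsupport_subset' := by
    have h1 : tsupport (fun x => φ (t, x)) ⊆ (fun x : ℝ => (t, x)) ⁻¹' tsupport φ :=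
      closure_minimal (fun x hx => subset_tsupport φ hx)
        ((isClosed_tsupport φ).preimage (by fun_prop))
    exact fun x hx => (φ.tsupport_subset (h1 hx)).2

/-- The distribution `w` on `I × J` is given by the curve `U : I → 𝓓'(J)`, i.e.
`⟨w, φ⟩ = ∫_I ⟨U(t), φ(t, ·)⟩ dt`. -/
def IsGivenByCurve {I J : Opens ℝ} (w : 𝓓'(rect I J, ℝ)) (U : ℝ → 𝓓'(J, ℝ)) : Prop :=
  ∀ φ : 𝓓(rect I J, ℝ), w φ = ∫ t in (I : Set ℝ), U t (sliceTest φ t)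

/-- `u` is `C^q`-semiregular in `t`: for all open intervals `I`, `J` with `I × J ⊆ Ω`, the
restriction of `u` to `I × J` belongs to `C^q(I, 𝓓'(J))`. Here `𝓓'(J)` carries its usual
topology, that of uniform convergence on compact (equivalently, bounded) sets of test functions. -/
def IsSemiregular (q : ℕ∞) {Ω : Opens (ℝ × ℝ)} (u : 𝓓'(Ω, ℝ)) : Prop :=
  ∀ (I J : Opens ℝ), OrdConnected (I : Set ℝ) → OrdConnected (J : Set ℝ) →
    ∀ h : rect I J ≤ Ω,
      ∃ U : ℝ → 𝓓'(J, ℝ), IsCurveOfClass q I U ∧ IsGivenByCurve (restrictDistr h u) U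

/-! ### Systems `v_x = A v + F` -/

/-- `v ∈ 𝓓'(Ω, ℝᵖ) = 𝓓'(Ω)ᵖ` solves `v_x = A v + F` in the sense of distributions. -/
def IsDistrSolution {p : ℕ} {Ω : Opens (ℝ × ℝ)} {A : ℝ × ℝ → Matrix (Fin p) (Fin p) ℝ}
    (hA : ∀ i j, ContDiffOn ℝ ∞ (fun z => A z i j) Ω) (F : ℝ × ℝ → Fin p → ℝ)
    (v : Fin p → 𝓓'(Ω, ℝ)) : Prop :=
  ∀ i, xDerivDistr (v i) =
    ∑ j, mulDistr (hA i j) (v j) + regularDistr Ω (fun z => F z i)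

/-- `ψ` is a classical solution of `v_x = A v + F` on `Ω`: it belongs to `C^1_x(Ω, ℝᵖ)` and
satisfies the system pointwise. -/
def IsClassicalSolution {p : ℕ} (Ω : Set (ℝ × ℝ)) (A : ℝ × ℝ → Matrix (Fin p) (Fin p) ℝ)
    (F : ℝ × ℝ → Fin p → ℝ) (ψ : ℝ × ℝ → Fin p → ℝ) : Prop :=
  IsCx 1 Ω ψ ∧ ∀ z ∈ Ω, xDeriv 1 ψ z = A z *ᵥ ψ z + F z

/-! ### Scalar equations `∑_{k ≤ p} g_k ∂_x^k u = f` -/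

/-- `u ∈ 𝓓'(Ω)` solves `∑_{k ≤ p} g_k ∂_x^k u = f` in the sense of distributions. -/
def IsScalarDistrSolution {p : ℕ} {Ω : Opens (ℝ × ℝ)} {g : Fin (p + 1) → ℝ × ℝ → ℝ}
    (hg : ∀ k, ContDiffOn ℝ ∞ (g k) Ω) (f : ℝ × ℝ → ℝ) (u : 𝓓'(Ω, ℝ)) : Prop :=
  ∑ k, mulDistr (hg k) (xDerivDistr^[(k : ℕ)] u) = regularDistr Ω f

/-- `ψ` is a classical solution of `∑_{k ≤ p} g_k ∂_x^k u = f` on `Ω`: it belongs to `C^p_x(Ω)`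
and satisfies the equation pointwise. -/
def IsScalarClassicalSolution {p : ℕ} (Ω : Set (ℝ × ℝ)) (g : Fin (p + 1) → ℝ × ℝ → ℝ)
    (f : ℝ × ℝ → ℝ) (ψ : ℝ × ℝ → ℝ) : Prop :=
  IsCx p Ω ψ ∧ ∀ z ∈ Ω, ∑ k, g k z * xDeriv k ψ z = f z

end ParamODE

namespace ParamODE

open scoped BoundedContinuousFunction

/-! ### Smooth families of continuous functions on the unit interval -/

section Curry

/-! The problem is local, and locally variation of constants turns the system into `W_x = Ψ F`. Near
a given point there is a smooth invertible matrix `Ψ` with `Ψ_x = -Ψ A`, with inverse `Θ`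
(`exists_fundamental_matrix`). For a distributional solution `v`, the product rule shows that `W = Ψ
v` satisfies `W_x = Ψ F` (`IsDistrSolution.sum_evalAt_xPartial`). If `H` is a primitive of `Ψ F` in
`x`, then `W - H` has zero `x`-derivative. It is therefore determined by its values on products
`m(t) χ(x)` with one fixed `χ` of integral one (`eq_integral_of_xPartial_eq_zero`).

This is where semiregularity enters. A distribution in `t` alone could be arbitrary, but pairing a
`C^q` curve in `𝓓'(J)` with a smoothly varying test function gives a `C^q` function of `t`
(`IsCurveOfClass.contDiffOn_apply_sliceOn`). Hence `W - H` is a function `e(t)` of class `C^q`, and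
`v = Θ (e + H)` near the point. Continuous local representatives of the same distribution agree on
overlaps, so they glue (`glue_represents`). The order `q` is a parameter throughout; the cases `0`
and `⊤` are specializations.

The smoothness of `Ψ` jointly in `(t, x)` comes from inverting an operator in a Banach algebra:
scaled to `[0, 1]`, the integral equation for `Ψ` reads `Y - V (Y B) = 1`, with `V` the Volterra
operator and `B` depending smoothly on the point `(t, x)`.

A scalar equation is reduced to its companion system for `(u, u_x, …)`, since `x`-derivatives of
semiregular distributions are semiregular. -/

/-- The partial application of a continuous function on `E × ℝ`, as a continuous function on
the unit interval. -/
noncomputable def curryUnit {E F : Type} [TopologicalSpace E] [NormedAddCommGroup F]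
    (f : E × ℝ → F) (hf : Continuous f) (z : E) : unitInterval →ᵇ F :=
  BoundedContinuousFunction.mkOfCompact ⟨fun s => f (z, s), by fun_prop⟩

theorem curryUnit_apply {E F : Type} [TopologicalSpace E] [NormedAddCommGroup F]
    (f : E × ℝ → F) (hf : Continuous f) (z : E) (s : unitInterval) :
    curryUnit f hf z s = f (z, s) := rfl

theorem continuous_curryUnit {E F : Type} [TopologicalSpace E] [NormedAddCommGroup F]
    (f : E × ℝ → F) (hf : Continuous f) : Continuous (curryUnit f hf) := by
  have h : Continuous fun z : E => (⟨fun s => f (z, s), by fun_prop⟩ : C(unitInterval, F)) :=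
    ContinuousMap.continuous_of_continuous_uncurry _
      (by
        change Continuous fun p : E × unitInterval => f (p.1, (p.2 : ℝ))
        fun_prop)
  exact (ContinuousMap.isometryEquivBoundedOfCompact unitInterval F).continuous.comp h

variable {E : Type} [NormedAddCommGroup E] [NormedSpace ℝ E]

/-- Evaluation of a family of linear maps at a vector, linearly in the vector. -/
noncomputable def flipUnit (E F : Type) [NormedAddCommGroup E] [NormedSpace ℝ E]
    [NormedAddCommGroup F] [NormedSpace ℝ F] :
    (unitInterval →ᵇ E →L[ℝ] F) →L[ℝ] E →L[ℝ] unitInterval →ᵇ F :=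
  LinearMap.mkContinuous₂
    (LinearMap.mk₂ ℝ
      (fun (g : unitInterval →ᵇ E →L[ℝ] F) (e : E) =>
        (ContinuousLinearMap.apply ℝ F e).compLeftContinuousBounded unitInterval g)
      (fun g g' e => by ext; simp) (fun c g e => by ext; simp)
      (fun g e e' => by ext; simp) (fun c g e => by ext; simp)) 1 fun g e => by
    rw [one_mul, BoundedContinuousFunction.norm_le (by positivity)]
    exact fun s => (g s).le_of_opNorm_le (g.norm_coe_le_norm s) e

/-- The mean value inequality, made uniform in `s`: `curryUnit f'` is continuous for the sup norm,
so one radius `δ` serves every `s`. `flipUnit` only exchanges the order of the arguments. -/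
theorem hasFDerivAt_curryUnit {F : Type} [NormedAddCommGroup F]
    [NormedSpace ℝ F] {f : E × ℝ → F} (hf : Continuous f) {f' : E × ℝ → E →L[ℝ] F}
    (hf' : Continuous f') (h : ∀ z s, HasFDerivAt (fun z => f (z, s)) (f' (z, s)) z) (z₀ : E) :
    HasFDerivAt (curryUnit f hf) (flipUnit E F (curryUnit f' hf' z₀)) z₀ := by
  rw [hasFDerivAt_iff_isLittleO, Asymptotics.isLittleO_iff]
  intro ε hε
  have hc := (continuous_curryUnit f' hf').continuousAt (x := z₀)
  obtain ⟨δ, hδ, hball⟩ := Metric.continuousAt_iff.1 hc ε hε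
  filter_upwards [Metric.ball_mem_nhds z₀ hδ] with z hz
  rw [BoundedContinuousFunction.norm_le (by positivity)]
  intro s
  refine (convex_ball z₀ δ).norm_image_sub_le_of_norm_hasFDerivWithin_le'
    (f := fun z => f (z, (s : ℝ))) (f' := fun z => f' (z, (s : ℝ)))
    (φ := f' (z₀, (s : ℝ))) (fun w _ => (h w s).hasFDerivWithinAt) (fun w hw => ?_)
    (Metric.mem_ball_self hδ) hz
  have h1 : dist (curryUnit f' hf' w s) (curryUnit f' hf' z₀ s) ≤ ε :=
    (BoundedContinuousFunction.dist_coe_le_dist s).trans (hball hw).le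
  rwa [dist_eq_norm] at h1

/-- Induction on the order. The target space has to vary, because the partial derivative takes
values in `E →L[ℝ] F`. -/
theorem contDiff_curryUnit {F : Type} [NormedAddCommGroup F]
    [NormedSpace ℝ F] {f : E × ℝ → F} (hf : Continuous f) {n : ℕ∞} (h : ContDiff ℝ n f) :
    ContDiff ℝ n (curryUnit f hf) := by
  suffices H : ∀ (k : ℕ) (F : Type) [NormedAddCommGroup F] [NormedSpace ℝ F] (f : E × ℝ → F)
      (hf : Continuous f), ContDiff ℝ k f → ContDiff ℝ k (curryUnit f hf) by
    rw [contDiff_iff_forall_nat_le]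
    exact fun k hk => H k F f hf (h.of_le (by exact_mod_cast hk))
  intro k
  induction k with
  | zero =>
    intro F _ _ f hf _
    exact contDiff_zero.2 (continuous_curryUnit f hf)
  | succ k ih =>
    intro F _ _ f hf h
    have hd : ContDiff ℝ k fun p => (fderiv ℝ f p).comp (ContinuousLinearMap.inl ℝ E ℝ) :=
      (h.fderiv_right (m := k) (by norm_cast)).clm_comp contDiff_const
    refine contDiff_succ_iff_hasFDerivAt.2
      ⟨fun z => flipUnit E F (curryUnit _ hd.continuous z),
        (ih _ _ hd.continuous hd).continuousLinearMap_comp (flipUnit E F), fun z => ?_⟩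
    refine hasFDerivAt_curryUnit hf hd.continuous (fun z s => ?_) z
    have h1 : HasFDerivAt f (fderiv ℝ f (z, s)) (z, s) :=
      (h.differentiable (by simp) _).hasFDerivAt
    exact h1.comp z (hasFDerivAt_prodMk_left z s)

theorem contDiffAt_apply_unit {F : Type} [NormedAddCommGroup F] [NormedSpace ℝ F]
    {Y : E → unitInterval →ᵇ F} {n : ℕ∞} {z : E} (hY : ContDiffAt ℝ n Y z) (s : unitInterval) :
    ContDiffAt ℝ n (fun w => Y w s) z := by
  let T : (unitInterval →ᵇ F) →L[ℝ] F :=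
    LinearMap.mkContinuous ⟨⟨fun g => g s, fun _ _ => rfl⟩, fun _ _ => rfl⟩ 1
      fun g => by simpa using g.norm_coe_le_norm s
  exact hY.continuousLinearMap_comp T

end Curry

/-! ### The integration operator on the unit interval -/

section Volterra

variable {F : Type} [NormedAddCommGroup F]

theorem continuous_comp_projIcc (Y : unitInterval →ᵇ F) :
    Continuous fun τ : ℝ => Y (projIcc 0 1 zero_le_one τ) :=
  Y.continuous.comp continuous_projIcc

variable [NormedSpace ℝ F]

/-- The operator `Y ↦ (s ↦ ∫₀ˢ Y)`. -/
noncomputable def volterra (F : Type) [NormedAddCommGroup F] [NormedSpace ℝ F] :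
    (unitInterval →ᵇ F) →L[ℝ] unitInterval →ᵇ F :=
  LinearMap.mkContinuous
    { toFun := fun Y => BoundedContinuousFunction.mkOfCompact
        ⟨fun s => ∫ τ in (0 : ℝ)..s, Y (projIcc 0 1 zero_le_one τ),
          (intervalIntegral.continuous_primitive
            (fun a b => (continuous_comp_projIcc Y).intervalIntegrable a b) 0).comp
            continuous_subtype_val⟩
      map_add' := fun Y Z => by
        ext s
        exact intervalIntegral.integral_add
          ((continuous_comp_projIcc Y).intervalIntegrable _ _)
          ((continuous_comp_projIcc Z).intervalIntegrable _ _)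
      map_smul' := fun c Y => by
        ext s
        exact intervalIntegral.integral_smul c _ } 1 fun Y => by
    rw [one_mul, BoundedContinuousFunction.norm_le (norm_nonneg _)]
    intro s
    refine (intervalIntegral.norm_integral_le_of_norm_le_const (C := ‖Y‖)
      fun x _ => Y.norm_coe_le_norm _).trans ?_
    rw [sub_zero, abs_of_nonneg s.2.1]
    exact mul_le_of_le_one_right (norm_nonneg _) s.2.2

/-- Integration is a continuous linear map on the space of functions on the interval, so
differentiating under the integral is the chain rule with `curryUnit`. -/
theorem contDiff_integral_unit {E : Type} [NormedAddCommGroup E] [NormedSpace ℝ E]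
    {f : E × ℝ → F} {n : ℕ∞} (hf : ContDiff ℝ n f) :
    ContDiff ℝ n fun z => ∫ s in (0 : ℝ)..1, f (z, s) := by
  have h1 : (fun z => ∫ s in (0 : ℝ)..1, f (z, s)) =
      fun z => volterra F (curryUnit f hf.continuous z) 1 := by
    funext z
    refine (intervalIntegral.integral_congr fun τ hτ => ?_).symm
    replace hτ : τ ∈ Icc (0 : ℝ) 1 := by simpa [uIcc_of_le] using hτ
    simp [curryUnit_apply, projIcc_of_mem zero_le_one hτ]
  rw [h1]
  exact contDiff_iff_contDiffAt.2 fun z => contDiffAt_apply_unit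
    ((contDiff_curryUnit hf.continuous hf).continuousLinearMap_comp (volterra F)).contDiffAt 1

end Volterra

/-! ### Primitives with respect to `x` -/

section Primitive

variable {F : Type} [NormedAddCommGroup F] [NormedSpace ℝ F]

/-- The primitive with respect to `x` of a function of `(t, x)` that vanishes for `x = a`. -/
noncomputable def xPrim (a : ℝ) (G : ℝ × ℝ → F) (z : ℝ × ℝ) : F :=
  ∫ y in a..z.2, G (z.1, y)

/-- The substitution `y = a + (x - a) s` moves the variable endpoint into the integrand. -/
theorem contDiff_xPrim (a : ℝ) {G : ℝ × ℝ → F} {n : ℕ∞} (hG : ContDiff ℝ n G) :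
    ContDiff ℝ n (xPrim a G) := by
  have hf : ContDiff ℝ n fun p : (ℝ × ℝ) × ℝ => G (p.1.1, a + (p.1.2 - a) * p.2) :=
    hG.comp (by fun_prop)
  have h1 : xPrim a G = fun z => (z.2 - a) •
      ∫ s in (0 : ℝ)..1, G (z.1, a + (z.2 - a) * s) := by
    funext z
    rw [intervalIntegral.smul_integral_comp_add_mul (fun y => G (z.1, y))]
    simp [xPrim]
  rw [h1]
  exact (contDiff_snd.sub contDiff_const).smul (contDiff_integral_unit hf)

theorem hasDerivAt_xPrim [CompleteSpace F] (a : ℝ) {G : ℝ × ℝ → F} (hG : Continuous G) (t x : ℝ) :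
    HasDerivAt (fun x => xPrim a G (t, x)) (G (t, x)) x :=
  (Continuous.integral_hasStrictDerivAt (f := fun y => G (t, y)) (by fun_prop) a x).hasDerivAt

end Primitive

/-! ### Linear differential equations depending smoothly on parameters -/

section Fundamental

variable {R : Type} [NormedRing R] [NormedAlgebra ℝ R] [CompleteSpace R]

omit [CompleteSpace R] in
/-- The equation `Y - V (Y B) = 1`, with a linear operator `V` and a smooth coefficient `B` that
vanishes at `z₀`, has a unique smooth solution near `z₀`. -/
theorem exists_contDiffAt_sub_mul_eq_one {E X : Type} [NormedAddCommGroup E] [NormedSpace ℝ E]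
    [NormedRing X] [NormedAlgebra ℝ X] [CompleteSpace X] (V : X →L[ℝ] X) {B : E → X}
    (hB : ContDiff ℝ ∞ B) {z₀ : E} (h₀ : B z₀ = 0) :
    ∃ Y : E → X, ∀ᶠ z in 𝓝 z₀, ContDiffAt ℝ ∞ Y z ∧ Y z - V (Y z * B z) = 1 ∧
      ∀ Z, Z - V (Z * B z) = 1 → Z = Y z := by
  let W : X →L[ℝ] X →L[ℝ] X :=
    (ContinuousLinearMap.compL ℝ X X X V).comp (ContinuousLinearMap.mul ℝ X).flip
  have hW : ∀ b Y, W b Y = V (Y * b) := fun b Y => rfl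
  -- The equation is `K z Y = 1`. Since `K z₀` is the identity, `K z` is a unit near `z₀`, and
  -- inversion is smooth on units.
  set K : E → X →L[ℝ] X := fun z => 1 - W (B z) with hKdef
  have hK : ContDiff ℝ ∞ K := contDiff_const.sub (W.contDiff.comp hB)
  have hKz : ∀ z Y, K z Y = Y - V (Y * B z) := fun z Y => rfl
  have hK0 : IsUnit (K z₀) := by simp [hKdef, h₀]
  refine ⟨fun z => Ring.inverse (K z) 1, ?_⟩
  filter_upwards [hK.continuous.continuousAt.eventually (Units.isOpen.mem_nhds hK0)] with z hz
  refine ⟨?_, congrArg (fun T : X →L[ℝ] X => T 1) (Ring.mul_inverse_cancel _ hz), fun Z hZ => ?_⟩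
  · obtain ⟨u, hu⟩ := hz
    have h1 : ContDiffAt ℝ ∞ (fun w => Ring.inverse (K w)) z :=
      ContDiffAt.comp (g := Ring.inverse) z (by rw [← hu]; exact contDiffAt_ringInverse ℝ u)
        hK.contDiffAt
    exact h1.clm_apply contDiffAt_const
  · have h1 := congrArg (fun T : X →L[ℝ] X => T Z) (Ring.inverse_mul_cancel _ hz)
    simp only [mul_apply_eq_comp, hKz, hZ, one_apply_eq_self] at h1
    exact h1.symm

omit [CompleteSpace R] in
theorem volterra_mul_apply (B Y : unitInterval →ᵇ R) (s : unitInterval) :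
    volterra R (Y * B) s = ∫ τ in (0 : ℝ)..s,
      Y (projIcc 0 1 zero_le_one τ) * B (projIcc 0 1 zero_le_one τ) := rfl

/-- On a neighbourhood of every point, the equation `Ψ_x = Ψ A` with smooth coefficients has an
invertible smooth solution. -/
theorem exists_fundamental_solution {A : ℝ × ℝ → R} (hA : ContDiff ℝ ∞ A) (z₀ : ℝ × ℝ) :
    ∃ r > 0, ∃ Ψ : ℝ × ℝ → R, ContDiffOn ℝ ∞ Ψ (Metric.ball z₀ r) ∧
      (∀ z ∈ Metric.ball z₀ r, IsUnit (Ψ z)) ∧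
      ∀ z ∈ Metric.ball z₀ r, HasDerivAt (fun x => Ψ (z.1, x)) (Ψ z * A z) z.2 := by
  obtain ⟨t₀, x₀⟩ := z₀
  -- With `y = x₀ + s (x - x₀)`, the equation `Ψ = 1 + ∫ Ψ A` along the segment from `(t, x₀)` to
  -- `(t, x)` becomes `Y = 1 + V (Y B)` on `[0, 1]`. The factor `x - x₀` makes `B` vanish at `(t₀,
  -- x₀)`.
  have hf : ContDiff ℝ ∞ fun p : (ℝ × ℝ) × ℝ =>
      (p.1.2 - x₀) • A (p.1.1, x₀ + p.2 * (p.1.2 - x₀)) :=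
    (contDiff_fst.snd.sub contDiff_const).smul (hA.comp (contDiff_fst.fst.prodMk
      (contDiff_const.add (contDiff_snd.mul (contDiff_fst.snd.sub contDiff_const)))))
  set B := curryUnit _ hf.continuous with hBdef
  have hB : ContDiff ℝ ∞ B := contDiff_curryUnit hf.continuous hf
  have hB0 : B (t₀, x₀) = 0 := by
    ext s
    simp [hBdef, curryUnit_apply]
  obtain ⟨Y, hYev⟩ := exists_contDiffAt_sub_mul_eq_one (volterra R) hB hB0
  set Ψ : ℝ × ℝ → R := fun z => Y z 1 with hΨdef
  have hΨ : ∀ z, ContDiffAt ℝ ∞ Y z → ContDiffAt ℝ ∞ Ψ z := fun z hz =>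
    contDiffAt_apply_unit hz 1
  have hΨ0 : Ψ (t₀, x₀) = 1 := by
    have h1 := hYev.self_of_nhds.2.1
    rw [hB0, mul_zero, map_zero, sub_zero] at h1
    simp [hΨdef, h1]
  have hunitΨ : ∀ᶠ z in 𝓝 (t₀, x₀), IsUnit (Ψ z) := by
    have h1 : IsUnit (Ψ (t₀, x₀)) := by rw [hΨ0]; exact isUnit_one
    exact (hΨ _ hYev.self_of_nhds.1).continuousAt.eventually (Units.isOpen.mem_nhds h1)
  obtain ⟨r, hr, hball⟩ := Metric.eventually_nhds_iff_ball.1 (hYev.and hunitΨ)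
  refine ⟨r, hr, Ψ, fun z hz => (hΨ z (hball z hz).1.1).contDiffWithinAt,
    fun z hz => (hball z hz).2, ?_⟩
  have hseg : ∀ z ∈ Metric.ball (t₀, x₀) r, ∀ σ : unitInterval,
      (z.1, x₀ + σ * (z.2 - x₀)) ∈ Metric.ball (t₀, x₀) r := by
    rintro ⟨t, x⟩ hz σ
    rw [← ball_prod_same] at hz ⊢
    refine ⟨hz.1, ?_⟩
    have h1 := hz.2
    simp only [Metric.mem_ball, Real.dist_eq] at h1 ⊢
    rw [add_sub_cancel_left, abs_mul, abs_of_nonneg σ.2.1]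
    exact (mul_le_of_le_one_left (abs_nonneg _) σ.2.2).trans_lt h1
  -- The rescaled function `s ↦ Y z (σ s)` solves the equation belonging to the point at fraction
  -- `σ` of the segment; uniqueness identifies it with the solution there.
  have hscale : ∀ z ∈ Metric.ball (t₀, x₀) r, ∀ σ : unitInterval,
      Y z σ = Ψ (z.1, x₀ + σ * (z.2 - x₀)) := by
    intro z hz σ
    set z' : ℝ × ℝ := (z.1, x₀ + σ * (z.2 - x₀)) with hz'
    let Z : unitInterval →ᵇ R :=
      BoundedContinuousFunction.mkOfCompact ⟨fun s => Y z (σ * s), by fun_prop⟩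
    have hZs : ∀ s, Z s = Y z (σ * s) := fun s => rfl
    have hZ : Z - volterra R (Z * B z') = 1 := by
      ext s
      have h1 := congrArg (fun f : unitInterval →ᵇ R => f (σ * s)) (hball z hz).1.2.1
      change Y z (σ * s) - volterra R (Y z * B z) (σ * s) = 1 at h1
      change Y z (σ * s) - volterra R (Z * B z') s = 1
      rw [← h1, volterra_mul_apply, volterra_mul_apply]
      congr 1
      have h2 := intervalIntegral.smul_integral_comp_mul_left (a := 0) (b := (s : ℝ))
        (fun τ => Y z (projIcc 0 1 zero_le_one τ) * B z (projIcc 0 1 zero_le_one τ)) (σ : ℝ)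
      rw [mul_zero] at h2
      rw [Icc.coe_mul, ← h2, ← intervalIntegral.integral_smul]
      refine intervalIntegral.integral_congr fun τ hτ => ?_
      rw [uIcc_of_le s.2.1] at hτ
      have hτ' : τ ∈ Icc (0 : ℝ) 1 := ⟨hτ.1, hτ.2.trans s.2.2⟩
      have hστ : (σ : ℝ) * τ ∈ Icc (0 : ℝ) 1 := unitInterval.mul_mem σ.2 hτ'
      have h3 : projIcc 0 1 zero_le_one ((σ : ℝ) * τ) = σ * projIcc 0 1 zero_le_one τ := by
        ext
        simp [projIcc_of_mem zero_le_one hτ', projIcc_of_mem zero_le_one hστ]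
      simp only [h3, hZs, ← mul_smul_comm]
      congr 1
      simp only [hBdef, curryUnit_apply, hz', projIcc_of_mem zero_le_one hτ',
        Icc.coe_mul, smul_smul, add_sub_cancel_left]
      congr 3
      ring
    have h4 := (hball z' (hseg z hz σ)).1.2.2 Z hZ
    rw [hΨdef]
    simp only [← h4, hZs, mul_one]
  -- Evaluation at `s = 1`, with the substitution undone by `hscale`; differentiating this integral
  -- equation gives the claim.
  have hint : ∀ z ∈ Metric.ball (t₀, x₀) r,
      Ψ z = 1 + ∫ y in x₀..z.2, Ψ (z.1, y) * A (z.1, y) := by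
    intro z hz
    have h1 := congrArg (fun f : unitInterval →ᵇ R => f 1) (hball z hz).1.2.1
    change Ψ z - volterra R (Y z * B z) 1 = 1 at h1
    rw [sub_eq_iff_eq_add.1 h1, volterra_mul_apply]
    congr 1
    have h2 := intervalIntegral.smul_integral_comp_add_mul (a := 0) (b := 1)
        (fun y => Ψ (z.1, y) * A (z.1, y)) (z.2 - x₀) x₀
    rw [mul_zero, add_zero, mul_one, add_sub_cancel] at h2
    rw [← h2, ← intervalIntegral.integral_smul]
    refine intervalIntegral.integral_congr fun τ hτ => ?_
    rw [Icc.coe_one, uIcc_of_le zero_le_one] at hτ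
    simp only [hscale z hz, hBdef, curryUnit_apply, projIcc_of_mem zero_le_one hτ,
      mul_smul_comm, mul_comm τ]
  have hcont : ContinuousOn Ψ (Metric.ball (t₀, x₀) r) := fun z hz =>
    (hΨ z (hball z hz).1.1).continuousAt.continuousWithinAt
  rintro ⟨t, x⟩ hz
  have hz2 := hz
  rw [← ball_prod_same] at hz2
  have hcx : ContinuousOn (fun y => Ψ (t, y) * A (t, y)) (Metric.ball x₀ r) := by
    refine ContinuousOn.mul (hcont.comp (by fun_prop) fun y hy => ?_)
      (hA.continuous.comp (by fun_prop : Continuous fun y : ℝ => (t, y))).continuousOn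
    rw [← ball_prod_same]
    exact ⟨hz2.1, hy⟩
  have hsub : uIcc x₀ x ⊆ Metric.ball x₀ r :=
    (convex_ball x₀ r).ordConnected.uIcc_subset (Metric.mem_ball_self hr) hz2.2
  have hx := Metric.isOpen_ball.mem_nhds hz2.2
  have h5 : HasDerivAt (fun u => 1 + ∫ y in x₀..u, Ψ (t, y) * A (t, y)) (Ψ (t, x) * A (t, x)) x :=
    (intervalIntegral.integral_hasDerivAt_right (hcx.mono hsub).intervalIntegrable
      (hcx.stronglyMeasurableAtFilter Metric.isOpen_ball x hz2.2)
      (hcx.continuousAt hx)).const_add 1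
  refine h5.congr_of_eventuallyEq ?_
  filter_upwards [hx] with y hy
  exact hint (t, y) (by rw [← ball_prod_same]; exact ⟨hz2.1, hy⟩)

end Fundamental
/-! ### Curves of test functions -/

/-- A jointly continuous family of functions supported in a fixed compact set depends continuously
on the parameter with respect to uniform convergence. -/
theorem continuous_boundedContinuousFunction_of_eqOn_zero {T X G : Type} [TopologicalSpace T]
    [TopologicalSpace X] [NormedAddCommGroup G] {K : Set X} (hK : IsCompact K)
    {g : T → X → G} (hg : Continuous fun p : T × X => g p.1 p.2)
    (h0 : ∀ t, ∀ x ∉ K, g t x = 0) {f : T → X →ᵇ G} (hf : ∀ t x, f t x = g t x) :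
    Continuous f := by
  rw [continuous_iff_continuousAt]
  intro t₀
  rw [ContinuousAt, BoundedContinuousFunction.tendsto_iff_tendstoUniformly]
  intro u hu
  obtain ⟨v, hv, hvu⟩ := hK.mem_uniformity_of_prod (f := g) (s := univ) (q := t₀)
    hg.continuousOn (mem_univ _) (symm_le_uniformity hu)
  rw [nhdsWithin_univ] at hv
  filter_upwards [hv] with t ht x
  by_cases hx : x ∈ K
  · rw [hf, hf]
    exact hvu t ht x hx
  · rw [hf, hf, h0 _ _ hx, h0 _ _ hx]
    exact refl_mem_uniformity hu

/-- The slice `x ↦ B (t, x)` of a smooth function supported in `ℝ × K`. -/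
noncomputable def sliceIn {K : Compacts ℝ} {B : ℝ × ℝ → ℝ} (hB : ContDiff ℝ ∞ B)
    (h0 : ∀ t, ∀ x ∉ K, B (t, x) = 0) (t : ℝ) : 𝓓_{K}(ℝ, ℝ) where
  toFun x := B (t, x)
  contDiff' := hB.comp (by fun_prop)
  zero_on_compl' x hx := h0 t x hx

theorem iteratedFDeriv_slice {B : ℝ × ℝ → ℝ} (hB : ContDiff ℝ ∞ B) (i : ℕ) (t x : ℝ) :
    iteratedFDeriv ℝ i (fun x => B (t, x)) x =
      ContinuousMultilinearMap.compContinuousLinearMapL (fun _ => ContinuousLinearMap.inr ℝ ℝ ℝ)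
        (iteratedFDeriv ℝ i B (t, x)) := by
  have h1 : (fun x => B (t, x)) =
      (fun z => B ((t, 0) + z)) ∘ ContinuousLinearMap.inr ℝ ℝ ℝ := by
    funext y
    simp
  have h2 : ContDiff ℝ ∞ fun z => B ((t, 0) + z) := hB.comp (by fun_prop)
  rw [h1, ContinuousLinearMap.iteratedFDeriv_comp_right _ h2 x (i := i)
    (by exact_mod_cast le_top), iteratedFDeriv_comp_add_left]
  simp

/-- Continuity into `𝓓_{K}` is tested by sup norms of iterated derivatives, each of which is jointly
continuous and vanishes for `x` off `K`. -/
theorem continuous_sliceIn {K : Compacts ℝ} {B : ℝ × ℝ → ℝ} (hB : ContDiff ℝ ∞ B)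
    (h0 : ∀ t, ∀ x ∉ K, B (t, x) = 0) : Continuous (sliceIn hB h0) := by
  rw [ContDiffMapSupportedIn.continuous_iff_comp]
  intro i
  refine continuous_boundedContinuousFunction_of_eqOn_zero K.isCompact
    (g := fun t => iteratedFDeriv ℝ i (fun x => B (t, x))) ?_ (fun t x hx => ?_) fun t x => ?_
  · simp_rw [iteratedFDeriv_slice hB]
    exact (ContinuousLinearMap.continuous _).comp
      ((hB.continuous_iteratedFDeriv (by exact_mod_cast le_top)).comp (by fun_prop))
  · exact (sliceIn hB h0 t).iteratedFDeriv_zero_on_compl hx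
  · exact congrFun (ContDiffMapSupportedIn.structureMapCLM_top_apply ℝ (sliceIn hB h0 t)) x

/-- The partial derivative with respect to `t`. -/
noncomputable def tPartial (B : ℝ × ℝ → ℝ) (z : ℝ × ℝ) : ℝ := fderiv ℝ B z (1, 0)

theorem contDiff_tPartial {B : ℝ × ℝ → ℝ} (hB : ContDiff ℝ ∞ B) : ContDiff ℝ ∞ (tPartial B) :=
  (hB.fderiv_right (m := ∞) (by norm_cast)).clm_apply contDiff_const

theorem hasDerivAt_tPartial {B : ℝ × ℝ → ℝ} (hB : ContDiff ℝ ∞ B) (t x : ℝ) :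
    HasDerivAt (fun t => B (t, x)) (tPartial B (t, x)) t := by
  have h1 : HasFDerivAt B (fderiv ℝ B (t, x)) (t, x) :=
    (hB.differentiable (by simp) _).hasFDerivAt
  exact h1.comp_hasDerivAt t ((hasDerivAt_id t).prodMk (hasDerivAt_const t x))

theorem tPartial_eq_zero {K : Compacts ℝ} {B : ℝ × ℝ → ℝ} (hB : ContDiff ℝ ∞ B)
    (h0 : ∀ t, ∀ x ∉ K, B (t, x) = 0) : ∀ t, ∀ x ∉ K, tPartial B (t, x) = 0 := by
  intro t x hx
  have h1 := hasDerivAt_tPartial hB t x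
  simp only [h0 _ x hx] at h1
  exact h1.unique (hasDerivAt_const t (0 : ℝ))

/-- The curve of slices of a smooth function is differentiable, and its derivative is the curve of
slices of the partial derivative with respect to `t`. -/
theorem tendsto_slope_sliceIn {K : Compacts ℝ} {B : ℝ × ℝ → ℝ} (hB : ContDiff ℝ ∞ B)
    (h0 : ∀ t, ∀ x ∉ K, B (t, x) = 0) (t₀ : ℝ) :
    Tendsto (slope (sliceIn hB h0) t₀) (𝓝[≠] t₀)
      (𝓝 (sliceIn (contDiff_tPartial hB) (tPartial_eq_zero hB h0) t₀)) := by
  -- Hadamard's quotient: `Q` is smooth across `t = t₀`, equals the difference quotient elsewhere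
  -- and `∂_t B` at `t₀`. Convergence of the slopes is then continuity of the slices of `Q`.
  set Q : ℝ × ℝ → ℝ := fun z => ∫ s in (0 : ℝ)..1, tPartial B (t₀ + (z.1 - t₀) * s, z.2)
    with hQdef
  have hQ : ContDiff ℝ ∞ Q := contDiff_integral_unit (n := ⊤)
    (f := fun p : (ℝ × ℝ) × ℝ => tPartial B (t₀ + (p.1.1 - t₀) * p.2, p.1.2))
    ((contDiff_tPartial hB).comp (by fun_prop))
  have hQ0 : ∀ t, ∀ x ∉ K, Q (t, x) = 0 := by
    intro t x hx
    simp [hQdef, tPartial_eq_zero hB h0 _ x hx]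
  have hQB : ∀ t x, (t - t₀) * Q (t, x) = B (t, x) - B (t₀, x) := by
    intro t x
    have h1 := intervalIntegral.smul_integral_comp_add_mul (a := 0) (b := 1)
        (fun t => tPartial B (t, x)) (t - t₀) t₀
    rw [mul_zero, add_zero, mul_one, add_sub_cancel] at h1
    simp only [hQdef]
    rw [← smul_eq_mul, h1]
    refine intervalIntegral.integral_eq_sub_of_hasDerivAt (fun s _ => hasDerivAt_tPartial hB s x) ?_
    exact ((contDiff_tPartial hB).continuous.comp
      (by fun_prop : Continuous fun s : ℝ => (s, x))).intervalIntegrable _ _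
  have h2 : sliceIn (contDiff_tPartial hB) (tPartial_eq_zero hB h0) t₀ = sliceIn hQ hQ0 t₀ := by
    ext x
    change tPartial B (t₀, x) = Q (t₀, x)
    simp [hQdef]
  rw [h2]
  refine ((continuous_sliceIn hQ hQ0).tendsto t₀).mono_left nhdsWithin_le_nhds |>.congr' ?_
  filter_upwards [self_mem_nhdsWithin] with t ht
  ext x
  change Q (t, x) = (t - t₀)⁻¹ * (B (t, x) - B (t₀, x))
  rw [← hQB, inv_mul_cancel_left₀ (sub_ne_zero.2 ht)]

/-! ### Pairing of a curve of distributions with a curve of test functions -/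

/-- Convergence in `𝓓'(J)` is uniform on compact sets of test functions, and `b` maps a compact
neighbourhood of `t₀` to such a set; this allows the test function to move. -/
theorem tendsto_apply_of_tendsto_distr {J : Opens ℝ} {V : ℝ → 𝓓'(J, ℝ)} {V₀ : 𝓓'(J, ℝ)}
    {b : ℝ → 𝓓(J, ℝ)} (hb : Continuous b) {t₀ : ℝ} {l : Filter ℝ} (hl : l ≤ 𝓝 t₀)
    (hV : Tendsto V l (𝓝 V₀)) : Tendsto (fun t => V t (b t)) l (𝓝 (V₀ (b t₀))) := by
  rw [UniformConvergenceCLM.tendsto_iff_tendstoUniformlyOn] at hV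
  have hS : IsCompact (b '' Metric.closedBall t₀ 1) :=
    (isCompact_closedBall t₀ 1).image hb
  have h1 := hV _ hS
  have h2 : Tendsto (fun t => V₀ (b t)) l (𝓝 (V₀ (b t₀))) :=
    ((V₀.continuous.comp hb).tendsto t₀).mono_left hl
  rw [Metric.tendstoUniformlyOn_iff] at h1
  rw [Metric.tendsto_nhds] at h2 ⊢
  intro ε hε
  filter_upwards [h1 (ε / 2) (half_pos hε), h2 (ε / 2) (half_pos hε),
    hl (Metric.closedBall_mem_nhds t₀ one_pos)] with t h3 h4 h5
  have h6 := h3 (b t) ⟨t, h5, rfl⟩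
  rw [dist_comm] at h6
  calc _ ≤ dist (V t (b t)) (V₀ (b t)) + dist (V₀ (b t)) (V₀ (b t₀)) := dist_triangle _ _ _
    _ < ε := by linarith

/-- The slice `x ↦ B (t, x)` of a smooth function supported in `ℝ × K`, as a test function
on an open set that contains `K`. -/
noncomputable def sliceOn {K : Compacts ℝ} {J : Opens ℝ} (hKJ : (K : Set ℝ) ⊆ J) {B : ℝ × ℝ → ℝ}
    (hB : ContDiff ℝ ∞ B) (h0 : ∀ t, ∀ x ∉ K, B (t, x) = 0) (t : ℝ) : 𝓓(J, ℝ) :=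
  TestFunction.ofSupportedInCLM ℝ hKJ (sliceIn hB h0 t)

theorem continuous_sliceOn {K : Compacts ℝ} {J : Opens ℝ} (hKJ : (K : Set ℝ) ⊆ J)
    {B : ℝ × ℝ → ℝ} (hB : ContDiff ℝ ∞ B) (h0 : ∀ t, ∀ x ∉ K, B (t, x) = 0) :
    Continuous (sliceOn hKJ hB h0) :=
  (TestFunction.ofSupportedInCLM ℝ hKJ).continuous.comp (continuous_sliceIn hB h0)

/-- The pairing of a curve of distributions of class `C^q` with the slices of a smooth function is
a function of class `C^q`. -/
theorem IsCurveOfClass.contDiffOn_apply_sliceOn {q : ℕ∞} {I J : Opens ℝ} {U : ℝ → 𝓓'(J, ℝ)}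
    (hU : IsCurveOfClass q I U) {K : Compacts ℝ} (hKJ : (K : Set ℝ) ⊆ J)
    {B : ℝ × ℝ → ℝ} (hB : ContDiff ℝ ∞ B) (h0 : ∀ t, ∀ x ∉ K, B (t, x) = 0) :
    ContDiffOn ℝ q (fun t => U t (sliceOn hKJ hB h0 t)) I := by
  obtain ⟨D, rfl, hDc, hDs⟩ := hU
  -- The derivative of the pairing of `D k` with `B` involves `D (k + 1)` with `B` and `D k` with
  -- `∂_t B`, so `k` and `B` vary in the induction; `k + n ≤ q` keeps the derivatives available.
  suffices H : ∀ (n k : ℕ) (B : ℝ × ℝ → ℝ) (hB : ContDiff ℝ ∞ B)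
      (h0 : ∀ t, ∀ x ∉ K, B (t, x) = 0), ((k + n : ℕ) : ℕ∞) ≤ q →
      ContDiffOn ℝ n (fun t => D k t (sliceOn hKJ hB h0 t)) I by
    rw [contDiffOn_iff_forall_nat_le]
    exact fun m hm => H m 0 B hB h0 (by simpa using hm)
  intro n
  induction n with
  | zero =>
    intro k B hB h0 hk
    refine contDiffOn_zero.2 fun t₀ ht₀ => ?_
    exact tendsto_apply_of_tendsto_distr (continuous_sliceOn hKJ hB h0) nhdsWithin_le_nhds
      (hDc k hk t₀ ht₀)
  | succ n ih =>
    intro k B hB h0 hk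
    have hderiv : ∀ t ∈ (I : Set ℝ), HasDerivAt (fun t => D k t (sliceOn hKJ hB h0 t))
        (D (k + 1) t (sliceOn hKJ hB h0 t) +
          D k t (sliceOn hKJ (contDiff_tPartial hB) (tPartial_eq_zero hB h0) t)) t := by
      intro t₀ ht₀
      rw [hasDerivAt_iff_tendsto_slope]
      have hkq : (k : ℕ∞) < q := lt_of_lt_of_le (by norm_cast; omega) hk
      -- Product rule for slopes: the slope of `D k` at the moving test function, plus the fixed `D
      -- k t₀` at the slope of the slices.
      have h1 := tendsto_apply_of_tendsto_distr (continuous_sliceOn hKJ hB h0)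
        nhdsWithin_le_nhds (hDs k hkq t₀ ht₀)
      have h2 := (((map_continuous (D k t₀)).comp
        (TestFunction.ofSupportedInCLM ℝ hKJ).continuous).tendsto _).comp
        (tendsto_slope_sliceIn hB h0 t₀)
      refine (h1.add h2).congr fun t => ?_
      have h3 : ∀ (c : ℝ) (φ ψ : 𝓓(J, ℝ)), D k t₀ (c • (φ - ψ)) = c * (D k t₀ φ - D k t₀ ψ) :=
        fun c φ ψ => by rw [map_smul, map_sub, smul_eq_mul]
      change (t - t₀)⁻¹ • (D k t (sliceOn hKJ hB h0 t) - D k t₀ (sliceOn hKJ hB h0 t)) +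
        D k t₀ ((t - t₀)⁻¹ • (sliceOn hKJ hB h0 t - sliceOn hKJ hB h0 t₀)) =
        (t - t₀)⁻¹ • (D k t (sliceOn hKJ hB h0 t) - D k t₀ (sliceOn hKJ hB h0 t₀))
      rw [h3, smul_eq_mul, smul_eq_mul]
      ring
    have h3 : ((n + 1 : ℕ) : ℕ∞ω) = (n : ℕ∞ω) + 1 := by norm_cast
    rw [h3, contDiffOn_succ_iff_deriv_of_isOpen I.isOpen]
    refine ⟨fun t ht => (hderiv t ht).differentiableAt.differentiableWithinAt,
      fun h => by simp at h, ?_⟩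
    refine ContDiffOn.congr (ContDiffOn.add (ih (k + 1) B hB h0 ?_)
      (ih k _ (contDiff_tPartial hB) (tPartial_eq_zero hB h0) ?_)) fun t ht => (hderiv t ht).deriv
    · rwa [add_right_comm, add_assoc]
    · exact le_trans (by norm_cast; omega) hk

/-! ### Distributions as functionals on unbundled test functions -/

section Eval

variable {E : Type} [NormedAddCommGroup E] [NormedSpace ℝ E]

/-- `g` is smooth with compact support contained in `V`. -/
structure IsTest (V : Set E) (g : E → ℝ) : Prop where
  contDiff : ContDiff ℝ ∞ g
  hasCompactSupport : HasCompactSupport g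
  tsupport_subset : tsupport g ⊆ V

namespace IsTest

variable {V W : Set E} {g h : E → ℝ}

theorem mono (hg : IsTest V g) (hVW : V ⊆ W) : IsTest W g :=
  ⟨hg.1, hg.2, hg.3.trans hVW⟩

theorem add (hg : IsTest V g) (hh : IsTest V h) : IsTest V fun z => g z + h z :=
  ⟨hg.1.add hh.1, hg.2.add hh.2, (tsupport_add g h).trans (union_subset hg.3 hh.3)⟩

theorem neg (hg : IsTest V g) : IsTest V fun z => -g z :=
  ⟨hg.1.neg, hg.2.neg, by
    have h1 : tsupport (fun z => -g z) = tsupport g := by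
      simp [tsupport, Function.support_fun_neg]
    rw [h1]
    exact hg.3⟩

theorem zero (V : Set E) : IsTest V fun _ => 0 :=
  ⟨contDiff_const, HasCompactSupport.zero, by simp [tsupport]⟩

theorem sum {ι : Type} {s : Finset ι} {f : ι → E → ℝ} (hf : ∀ i ∈ s, IsTest V (f i)) :
    IsTest V fun z => ∑ i ∈ s, f i z := by
  classical
  induction s using Finset.induction_on with
  | empty => simpa using IsTest.zero V
  | insert i s hi ih =>
    simp only [Finset.sum_insert hi]
    exact (hf i (by simp)).add (ih fun j hj => hf j (by simp [hj]))

theorem mul_left {a : E → ℝ} (hg : IsTest V g) (ha : ContDiff ℝ ∞ a) :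
    IsTest V fun z => a z * g z :=
  ⟨ha.mul hg.1, hg.2.mul_left, (tsupport_mul_subset_right).trans hg.3⟩

theorem mul_contDiffOn {a : E → ℝ} (hg : IsTest V g) {O : Set E} (hO : IsOpen O)
    (ha : ContDiffOn ℝ ∞ a O) (hVO : V ⊆ O) : IsTest V fun z => g z * a z :=
  ⟨contDiff_iff_contDiffAt.2 fun z => by
      by_cases hz : z ∈ O
      · exact hg.1.contDiffAt.mul (ha.contDiffAt (hO.mem_nhds hz))
      · have h1 : z ∉ tsupport g := fun h => hz (hVO (hg.3 h))
        refine (contDiffAt_const (c := (0 : ℝ))).congr_of_eventuallyEq ?_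
        filter_upwards [notMem_tsupport_iff_eventuallyEq.1 h1] with y hy
        simp [hy],
    hg.2.mul_right, (tsupport_mul_subset_left).trans hg.3⟩

theorem eq_zero (hg : IsTest V g) {z : E} (hz : z ∉ V) : g z = 0 :=
  image_eq_zero_of_notMem_tsupport fun h => hz (hg.3 h)

theorem integrable_mul [MeasureSpace E] [OpensMeasurableSpace E] (hg : IsTest V g)
    {ψ : E → ℝ} (hψ : LocallyIntegrableOn ψ V volume) : Integrable fun z => g z * ψ z := by
  have h1 := (hψ.integrableOn_compact_subset hg.3 hg.2)
  have h2 : IntegrableOn (fun z => g z * ψ z) (tsupport g) := by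
    have := h1.continuousOn_mul hg.1.continuous.continuousOn hg.2
    exact this
  rwa [integrableOn_iff_integrable_of_support_subset] at h2
  exact fun z hz => subset_tsupport g fun h => hz (by simp [h])

end IsTest

variable {Ω : Opens E}

theorem isTest_coe (φ : 𝓓(Ω, ℝ)) : IsTest (Ω : Set E) φ :=
  ⟨φ.contDiff, φ.hasCompactSupport, φ.tsupport_subset⟩

/-- The bundled test function. -/
noncomputable def IsTest.toTest {g : E → ℝ} (hg : IsTest (Ω : Set E) g) : 𝓓(Ω, ℝ) :=
  ⟨g, hg.1, hg.2, hg.3⟩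

open Classical in
/-- The value of a distribution at an unbundled test function. -/
noncomputable def evalAt (u : 𝓓'(Ω, ℝ)) (g : E → ℝ) : ℝ :=
  -- The value zero off test functions keeps `evalAt_distr_add` and `evalAt_distr_sum` valid for
  -- every `g`.
  if hg : IsTest (Ω : Set E) g then u hg.toTest else 0

theorem evalAt_eq (u : 𝓓'(Ω, ℝ)) {g : E → ℝ} (hg : IsTest (Ω : Set E) g) :
    evalAt u g = u hg.toTest := dif_pos hg

theorem evalAt_coe (u : 𝓓'(Ω, ℝ)) (φ : 𝓓(Ω, ℝ)) : evalAt u φ = u φ :=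
  evalAt_eq u (isTest_coe φ)

theorem evalAt_add (u : 𝓓'(Ω, ℝ)) {g h : E → ℝ} (hg : IsTest (Ω : Set E) g)
    (hh : IsTest (Ω : Set E) h) : evalAt u (fun z => g z + h z) = evalAt u g + evalAt u h := by
  rw [evalAt_eq u hg, evalAt_eq u hh, evalAt_eq u (hg.add hh), ← map_add]
  rfl

theorem evalAt_neg (u : 𝓓'(Ω, ℝ)) {g : E → ℝ} (hg : IsTest (Ω : Set E) g) :
    evalAt u (fun z => -g z) = -evalAt u g := by
  rw [evalAt_eq u hg, evalAt_eq u hg.neg, ← map_neg]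
  rfl

theorem evalAt_zero (u : 𝓓'(Ω, ℝ)) : evalAt u (fun _ => 0) = 0 := by
  rw [evalAt_eq u (IsTest.zero _)]
  exact map_zero u

theorem evalAt_sum (u : 𝓓'(Ω, ℝ)) {ι : Type} {s : Finset ι} {f : ι → E → ℝ}
    (hf : ∀ i ∈ s, IsTest (Ω : Set E) (f i)) :
    evalAt u (fun z => ∑ i ∈ s, f i z) = ∑ i ∈ s, evalAt u (f i) := by
  classical
  induction s using Finset.induction_on with
  | empty => simpa using evalAt_zero u
  | insert i s hi ih =>
    simp only [Finset.sum_insert hi]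
    rw [evalAt_add u (hf i (by simp)) (IsTest.sum fun j hj => hf j (by simp [hj])),
      ih fun j hj => hf j (by simp [hj])]

theorem distr_ext {u v : 𝓓'(Ω, ℝ)} (h : ∀ g, IsTest (Ω : Set E) g → evalAt u g = evalAt v g) :
    u = v := by
  ext φ
  rw [← evalAt_coe, ← evalAt_coe, h _ (isTest_coe φ)]

theorem evalAt_distr_add (u v : 𝓓'(Ω, ℝ)) (g : E → ℝ) :
    evalAt (u + v) g = evalAt u g + evalAt v g := by
  by_cases hg : IsTest (Ω : Set E) g
  · simp only [evalAt_eq _ hg]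
    rfl
  · simp [evalAt, hg]

theorem evalAt_distr_sum {ι : Type} (s : Finset ι) (u : ι → 𝓓'(Ω, ℝ)) (g : E → ℝ) :
    evalAt (∑ i ∈ s, u i) g = ∑ i ∈ s, evalAt (u i) g := by
  classical
  induction s using Finset.induction_on with
  | empty =>
    by_cases hg : IsTest (Ω : Set E) g
    · simp only [evalAt_eq _ hg, Finset.sum_empty]
      rfl
    · simp [evalAt, hg]
  | insert i s hi ih =>
    rw [Finset.sum_insert hi, Finset.sum_insert hi, evalAt_distr_add, ih]

theorem evalAt_mulDistr [FiniteDimensional ℝ E] {a : E → ℝ} (ha : ContDiffOn ℝ ∞ a Ω)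
    (u : 𝓓'(Ω, ℝ)) {g : E → ℝ} (hg : IsTest (Ω : Set E) g) :
    evalAt (mulDistr ha u) g = evalAt u fun z => g z * a z := by
  rw [evalAt_eq _ hg, evalAt_eq _ (hg.mul_contDiffOn Ω.isOpen ha subset_rfl)]
  rfl

theorem evalAt_restrictDistr {Ω' : Opens E} (h : Ω' ≤ Ω) (u : 𝓓'(Ω, ℝ)) {g : E → ℝ}
    (hg : IsTest (Ω' : Set E) g) : evalAt (restrictDistr h u) g = evalAt u g := by
  rw [evalAt_eq _ hg, evalAt_eq _ (hg.mono h)]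
  change u (TestFunction.monoCLM ℝ hg.toTest) = _
  congr 1
  ext z
  rw [TestFunction.monoCLM_apply, if_pos ⟨le_rfl, h⟩]
  rfl

theorem evalAt_regularDistr [MeasureSpace E] [OpensMeasurableSpace E] {ψ : E → ℝ}
    (hψ : LocallyIntegrableOn ψ Ω volume) {g : E → ℝ} (hg : IsTest (Ω : Set E) g) :
    evalAt (regularDistr Ω ψ) g = ∫ z, g z * ψ z := by
  rw [evalAt_eq _ hg]
  exact TestFunction.integralAgainstBilinCLM_eq_integral hψ

end Eval

/-! ### Gluing of local representations by continuous functions -/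

section Glue

variable {E : Type} [NormedAddCommGroup E] [NormedSpace ℝ E] [FiniteDimensional ℝ E]
  [MeasureSpace E] [BorelSpace E] [(volume : Measure E).IsAddHaarMeasure] {Ω : Opens E}

omit [FiniteDimensional ℝ E] [BorelSpace E] [(volume : Measure E).IsAddHaarMeasure] in
/-- On `V`, the distribution `u` is given by the function `ψ`. -/
def Represents (u : 𝓓'(Ω, ℝ)) (V : Set E) (ψ : E → ℝ) : Prop :=
  ∀ g, IsTest V g → evalAt u g = ∫ z, g z * ψ z

/-- The fundamental lemma of the calculus of variations gives equality almost everywhere; continuity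
on an open set removes the exception. -/
theorem Represents.eqOn {u : 𝓓'(Ω, ℝ)} {V V' W : Set E} {ψ ψ' : E → ℝ} (h : Represents u V ψ)
    (h' : Represents u V' ψ') (hW : IsOpen W) (hWV : W ⊆ V) (hWV' : W ⊆ V')
    (hψ : ContinuousOn ψ W) (hψ' : ContinuousOn ψ' W) : EqOn ψ ψ' W := by
  have hc := hψ.sub hψ'
  have h1 : ∀ᵐ z, z ∈ W → ψ z - ψ' z = 0 := by
    refine hW.ae_eq_zero_of_integral_contDiff_smul_eq_zero
      (hc.locallyIntegrableOn hW.measurableSet) fun g hg hgc hgW => ?_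
    have hgt : IsTest W g := ⟨hg, hgc, hgW⟩
    simp only [smul_eq_mul, mul_sub]
    rw [integral_sub (hgt.integrable_mul (hψ.locallyIntegrableOn hW.measurableSet))
      (hgt.integrable_mul (hψ'.locallyIntegrableOn hW.measurableSet)),
      ← h g (hgt.mono hWV), ← h' g (hgt.mono hWV'), sub_self]
  rw [← ae_restrict_iff' hW.measurableSet] at h1
  have h2 := Measure.eqOn_open_of_ae_eq (f := fun z => ψ z - ψ' z) (g := fun _ => 0)
    h1 hW hc continuousOn_const
  exact fun z hz => sub_eq_zero.1 (h2 hz)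

/-- A partition of unity over a finite cover of the support splits any test function into pieces
supported in single balls. -/
theorem eq_regularDistr_of_represents {u : 𝓓'(Ω, ℝ)} {r : E → ℝ} {ψ : E → ℝ}
    (hr : ∀ z ∈ Ω, 0 < r z) (hψ : ContinuousOn ψ Ω)
    (hrΩ : ∀ z ∈ Ω, Metric.ball z (r z) ⊆ Ω)
    (h : ∀ z ∈ Ω, Represents u (Metric.ball z (r z)) ψ) : u = regularDistr Ω ψ := by
  have hloc := hψ.locallyIntegrableOn (μ := volume) Ω.isOpen.measurableSet
  refine distr_ext fun g hg => ?_
  rw [evalAt_regularDistr hloc hg]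
  obtain ⟨s, hs, hcov⟩ := hg.2.isCompact.elim_nhds_subcover (fun z => Metric.ball z (r z))
    fun z hz => Metric.ball_mem_nhds z (hr z (hg.3 hz))
  obtain ⟨ρ, hρ⟩ := SmoothPartitionOfUnity.exists_isSubordinate (modelWithCornersSelf ℝ E)
    (isClosed_tsupport g) (fun z : s => Metric.ball (z : E) (r z)) (fun _ => Metric.isOpen_ball)
    (by simpa [iUnion_subtype] using hcov)
  have hsΩ : ∀ i : s, (i : E) ∈ Ω := fun i => hg.3 (hs i i.2)
  have hsm : ∀ i : s, ContDiff ℝ ∞ (ρ i) := fun i => (ρ i).contMDiff.contDiff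
  have htest : ∀ i : s, IsTest (Metric.ball (i : E) (r i)) fun z => ρ i z * g z := fun i =>
    ⟨(hsm i).mul hg.1, hg.2.mul_left, (tsupport_mul_subset_left).trans (hρ i)⟩
  have hsum : g = fun z => ∑ i, ρ i z * g z := by
    funext z
    by_cases hz : z ∈ tsupport g
    · have h1 := ρ.sum_eq_one hz
      rw [finsum_eq_sum_of_fintype] at h1
      rw [← Finset.sum_mul, h1, one_mul]
    · simp [image_eq_zero_of_notMem_tsupport hz]
  have h2 : (fun z => g z * ψ z) = fun z => ∑ i, ρ i z * g z * ψ z := by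
    funext z
    rw [← Finset.sum_mul, ← congrFun hsum z]
  rw [h2, integral_finsetSum _ fun i _ =>
    ((htest i).mono (hrΩ i (hsΩ i))).integrable_mul hloc]
  conv_lhs => rw [hsum]
  rw [evalAt_sum u fun i _ => (htest i).mono (hrΩ i (hsΩ i))]
  exact Finset.sum_congr rfl fun i _ => h i (hsΩ i) _ (htest i)

/-- Local representations of a distribution by continuous functions fit together. -/
theorem glue_represents {u : 𝓓'(Ω, ℝ)} {r : E → ℝ} {ψ : E → E → ℝ}
    (hr : ∀ z ∈ Ω, 0 < r z) (hrΩ : ∀ z ∈ Ω, Metric.ball z (r z) ⊆ Ω)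
    (hψ : ∀ z ∈ Ω, ContinuousOn (ψ z) (Metric.ball z (r z)))
    (h : ∀ z ∈ Ω, Represents u (Metric.ball z (r z)) (ψ z)) :
    (∀ z ∈ Ω, EqOn (fun w => ψ w w) (ψ z) (Metric.ball z (r z))) ∧
      u = regularDistr Ω fun w => ψ w w := by
  -- The glued function takes at `w` the value of the representative centred at `w`; it is compared
  -- with the one centred at `z` on the intersection of the two balls.
  have heq : ∀ z ∈ Ω, EqOn (fun w => ψ w w) (ψ z) (Metric.ball z (r z)) := by
    intro z hz w hw
    have hwΩ := hrΩ z hz hw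
    exact (h w hwΩ).eqOn (h z hz) (Metric.isOpen_ball.inter Metric.isOpen_ball) inter_subset_left
      inter_subset_right ((hψ w hwΩ).mono inter_subset_left) ((hψ z hz).mono inter_subset_right)
      ⟨Metric.mem_ball_self (hr w hwΩ), hw⟩
  refine ⟨heq, eq_regularDistr_of_represents hr (fun z hz => ?_) hrΩ fun z hz g hg => ?_⟩
  · have h1 := Metric.ball_mem_nhds z (hr z hz)
    exact (((hψ z hz).continuousAt h1).congr
      ((heq z hz).eventuallyEq_of_mem h1).symm).continuousWithinAt
  · rw [h z hz g hg]
    congr 1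
    funext w
    by_cases hw : w ∈ Metric.ball z (r z)
    · exact congrArg (g w * ·) (heq z hz hw).symm
    · simp [hg.eq_zero hw]

end Glue

/-! ### Fundamental matrices -/

section FundamentalMatrix

/-- A function of class `C^n` on `Ω` agrees on each compact subset with a global one. -/
theorem exists_contDiff_eqOn_of_contDiffOn {E : Type} [NormedAddCommGroup E] [NormedSpace ℝ E]
    [FiniteDimensional ℝ E] {Ω : Opens E} {a : E → ℝ} {n : ℕ∞}
    (ha : ContDiffOn ℝ n a Ω) {K : Compacts E} (hK : (K : Set E) ⊆ Ω) :
    ∃ g : E → ℝ, ContDiff ℝ n g ∧ EqOn g a K := by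
  obtain ⟨f, hf0, hf1, -⟩ :=
    exists_contMDiffMap_zero_one_nhds_of_isClosed (n := (⊤ : ℕ∞)) (modelWithCornersSelf ℝ E)
      (s := (Ω : Set E)ᶜ) (t := (K : Set E)) Ω.isOpen.isClosed_compl
      K.isCompact.isClosed (disjoint_compl_left_iff_subset.2 hK)
  have hf : ContDiff ℝ n f := f.contMDiff.contDiff.of_le (by exact_mod_cast le_top)
  refine ⟨fun x => f x * a x, contDiff_iff_contDiffAt.2 fun x => ?_, fun x hx => ?_⟩
  · by_cases hx : x ∈ (Ω : Set E)
    · exact hf.contDiffAt.mul (ha.contDiffAt (Ω.isOpen.mem_nhds hx))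
    · have h0 : ∀ᶠ y in 𝓝 x, f y = 0 := (eventually_nhdsSet_iff_forall.1 hf0) x hx
      refine (contDiffAt_const (c := (0 : ℝ))).congr_of_eventuallyEq ?_
      filter_upwards [h0] with y hy
      simp [hy]
  · have h1 : f x = 1 := (eventually_nhdsSet_iff_forall.1 hf1 x hx).self_of_nhds
    simp [h1]

/-- The inverse of a solution of `Ψ_x = -Ψ A` solves `Θ_x = A Θ`. -/
theorem hasDerivAt_ringInverse_of_hasDerivAt {R : Type} [NormedRing R] [NormedAlgebra ℝ R]
    [CompleteSpace R] {Ψ : ℝ → R} {a : R} {x : ℝ} (hu : IsUnit (Ψ x))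
    (h : HasDerivAt Ψ (Ψ x * -a) x) :
    HasDerivAt (fun x => Ring.inverse (Ψ x)) (a * Ring.inverse (Ψ x)) x := by
  obtain ⟨u, hu'⟩ := hu
  -- Inversion has derivative `h ↦ -Ψ⁻¹ h Ψ⁻¹`, and `h = -Ψ a` gives `a Ψ⁻¹`.
  have h1 : HasFDerivAt Ring.inverse
      (-ContinuousLinearMap.mulLeftRight ℝ R ↑u⁻¹ ↑u⁻¹) (Ψ x) := by
    rw [← hu']
    exact hasFDerivAt_ringInverse u
  have h2 := h1.comp_hasDerivAt x h
  refine h2.congr_deriv ?_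
  rw [← hu', Ring.inverse_unit]
  simp

theorem contDiff_linearMap_comp {E R : Type} [NormedAddCommGroup E] [NormedSpace ℝ E]
    [NormedAddCommGroup R] [NormedSpace ℝ R] [FiniteDimensional ℝ R] (l : R →ₗ[ℝ] ℝ) {n : ℕ∞ω}
    {f : E → R} {s : Set E} (hf : ContDiffOn ℝ n f s) : ContDiffOn ℝ n (fun z => l (f z)) s :=
  hf.continuousLinearMap_comp (LinearMap.toContinuousLinearMap l)

theorem hasDerivAt_linearMap_comp {R : Type}
    [NormedAddCommGroup R] [NormedSpace ℝ R] [FiniteDimensional ℝ R] (l : R →ₗ[ℝ] ℝ)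
    {f : ℝ → R} {f' : R} {x : ℝ} (hf : HasDerivAt f f' x) :
    HasDerivAt (fun x => l (f x)) (l f') x :=
  (LinearMap.toContinuousLinearMap l).hasFDerivAt.comp_hasDerivAt x hf

-- Any complete algebra norm on matrices would serve; the statement below is entrywise and
-- independent of the choice.
attribute [local instance] Matrix.linftyOpNormedRing Matrix.linftyOpNormedAlgebra

/-- Near every point, there is an invertible smooth matrix function `Ψ` with `Ψ_x = -Ψ A`; its
inverse `Θ` satisfies `Θ_x = A Θ`. -/
theorem exists_fundamental_matrix {p : ℕ} {A : ℝ × ℝ → Matrix (Fin p) (Fin p) ℝ}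
    (hA : ∀ i j, ContDiff ℝ ∞ fun z => A z i j) (z₀ : ℝ × ℝ) :
    ∃ r > 0, ∃ Ψ Θ : ℝ × ℝ → Matrix (Fin p) (Fin p) ℝ,
      (∀ i j, ContDiff ℝ ∞ fun z => Ψ z i j) ∧ (∀ i j, ContDiff ℝ ∞ fun z => Θ z i j) ∧
      ∀ z ∈ Metric.ball z₀ r, Θ z * Ψ z = 1 ∧
        (∀ i j, HasDerivAt (fun x => Ψ (z.1, x) i j) (-(Ψ z * A z) i j) z.2) ∧
        ∀ i j, HasDerivAt (fun x => Θ (z.1, x) i j) ((A z * Θ z) i j) z.2 := by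
  have hA' : ContDiff ℝ ∞ fun z => -A z := by
    have h1 : (fun z => -A z) = fun z => -∑ i, ∑ j, A z i j • Matrix.single i j (1 : ℝ) := by
      funext z
      conv_lhs => rw [Matrix.matrix_eq_sum_single (A z)]
      simp
    rw [h1]
    exact (ContDiff.sum fun i _ => ContDiff.sum fun j _ => (hA i j).smul contDiff_const).neg
  obtain ⟨r, hr, Ψ, hΨ, hu, hd⟩ := exists_fundamental_solution hA' z₀
  have hΘ : ContDiffOn ℝ ∞ (fun z => Ring.inverse (Ψ z)) (Metric.ball z₀ r) := by
    intro z hz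
    obtain ⟨u, hu'⟩ := hu z hz
    exact ContDiffAt.comp_contDiffWithinAt (g := Ring.inverse) z
      (by rw [← hu']; exact contDiffAt_ringInverse ℝ u) (hΨ z hz)
  have hent : ∀ i j : Fin p, ∃ l : Matrix (Fin p) (Fin p) ℝ →ₗ[ℝ] ℝ, ∀ M, l M = M i j :=
    fun i j => ⟨Matrix.entryLinearMap ℝ ℝ i j, fun M => rfl⟩
  choose l hl using hent
  -- On the half-radius ball the matrices are replaced by globally smooth ones, so that multiplying
  -- by their entries preserves test functions.
  have hext : ∀ M : ℝ × ℝ → Matrix (Fin p) (Fin p) ℝ, ContDiffOn ℝ ∞ M (Metric.ball z₀ r) →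
      ∃ M' : ℝ × ℝ → Matrix (Fin p) (Fin p) ℝ, (∀ i j, ContDiff ℝ ∞ fun z => M' z i j) ∧
        ∀ z ∈ Metric.closedBall z₀ (r / 2), M' z = M z := by
    intro M hM
    have h1 : ∀ i j, ∃ g : ℝ × ℝ → ℝ, ContDiff ℝ ∞ g ∧
        EqOn g (fun z => M z i j) (Metric.closedBall z₀ (r / 2)) := fun i j =>
      exists_contDiff_eqOn (Ω := ⟨Metric.ball z₀ r, Metric.isOpen_ball⟩)
        (K := ⟨Metric.closedBall z₀ (r / 2), isCompact_closedBall _ _⟩)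
        (by
          have h2 := contDiff_linearMap_comp (l i j) hM
          simp only [hl] at h2
          exact h2)
        (Metric.closedBall_subset_ball (half_lt_self hr))
    choose g hg hgM using h1
    exact ⟨fun z => Matrix.of fun i j => g i j z, hg, fun z hz => by
      ext i j
      exact hgM i j hz⟩
  obtain ⟨Ψ', hΨ', hΨe⟩ := hext Ψ hΨ
  obtain ⟨Θ', hΘ', hΘe⟩ := hext _ hΘ
  refine ⟨r / 2, half_pos hr, Ψ', Θ', hΨ', hΘ', fun z hz => ?_⟩
  have hzc := Metric.ball_subset_closedBall hz
  have hzr := Metric.ball_subset_ball (half_le_self hr.le) hz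
  have hev : ∀ᶠ x in 𝓝 z.2, (z.1, x) ∈ Metric.closedBall z₀ (r / 2) := by
    have h1 : ContinuousAt (fun x : ℝ => (z.1, x)) z.2 := by fun_prop
    filter_upwards [h1.eventually (Metric.isOpen_ball.mem_nhds hz)] with x hx
    exact Metric.ball_subset_closedBall hx
  rw [hΨe z hzc, hΘe z hzc]
  refine ⟨Ring.inverse_mul_cancel _ (hu z hzr), fun i j => ?_, fun i j => ?_⟩
  · have h1 := hasDerivAt_linearMap_comp (l i j) (hd z hzr)
    simp only [hl, mul_neg] at h1
    refine h1.congr_of_eventuallyEq ?_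
    filter_upwards [hev] with x hx
    rw [hΨe _ hx]
  · have h1 := hasDerivAt_linearMap_comp (l i j)
      (hasDerivAt_ringInverse_of_hasDerivAt (hu z hzr) (hd z hzr))
    simp only [hl] at h1
    refine h1.congr_of_eventuallyEq ?_
    filter_upwards [hev] with x hx
    rw [hΘe _ hx]

end FundamentalMatrix

/-! ### Derivatives of test functions with respect to `x` -/

/-- The partial derivative with respect to `x`. -/
noncomputable def xPartial (g : ℝ × ℝ → ℝ) (z : ℝ × ℝ) : ℝ := fderiv ℝ g z (0, 1)

theorem contDiff_xPartial {g : ℝ × ℝ → ℝ} (hg : ContDiff ℝ ∞ g) : ContDiff ℝ ∞ (xPartial g) :=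
  (hg.fderiv_right (m := ∞) (by norm_cast)).clm_apply contDiff_const

theorem hasDerivAt_xPartial {g : ℝ × ℝ → ℝ} (hg : ContDiff ℝ ∞ g) (t x : ℝ) :
    HasDerivAt (fun x => g (t, x)) (xPartial g (t, x)) x := by
  have h1 : HasFDerivAt g (fderiv ℝ g (t, x)) (t, x) :=
    (hg.differentiable (by simp) _).hasFDerivAt
  exact h1.comp_hasDerivAt x ((hasDerivAt_const x t).prodMk (hasDerivAt_id x))

theorem IsTest.xPartial {V : Set (ℝ × ℝ)} {g : ℝ × ℝ → ℝ} (hg : IsTest V g) :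
    IsTest V (xPartial g) :=
  ⟨contDiff_xPartial hg.1, hg.2.fderiv_apply ℝ _, (tsupport_fderiv_apply_subset ℝ _).trans hg.3⟩

theorem evalAt_xDerivDistr {Ω : Opens (ℝ × ℝ)} (u : 𝓓'(Ω, ℝ)) {g : ℝ × ℝ → ℝ}
    (hg : IsTest (Ω : Set (ℝ × ℝ)) g) : evalAt (xDerivDistr u) g = -evalAt u (xPartial g) := by
  rw [evalAt_eq _ hg, evalAt_eq _ hg.xPartial]
  have h1 : xDerivDistr u hg.toTest = u (-∂_{((0, 1) : ℝ × ℝ)} hg.toTest) :=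
    Distribution.lineDerivOp_apply_apply u hg.toTest (0, 1)
  rw [h1, map_neg]
  congr 2

/-! ### Functionals that vanish on derivatives with respect to `x` -/

section Constancy

theorem isTest_ball_of_eq_zero {E : Type} [NormedAddCommGroup E] [NormedSpace ℝ E]
    [FiniteDimensional ℝ E] {g : E → ℝ} {z₀ : E} {r r' : ℝ} (hg : ContDiff ℝ ∞ g) (hr : r' < r)
    (h0 : ∀ z ∉ Metric.closedBall z₀ r', g z = 0) : IsTest (Metric.ball z₀ r) g := by
  have := FiniteDimensional.proper ℝ E
  exact ⟨hg, HasCompactSupport.intro (isCompact_closedBall z₀ r') h0,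
    (closure_minimal (Function.support_subset_iff'.2 h0) Metric.isClosed_closedBall).trans
      (Metric.closedBall_subset_ball hr)⟩

/-- The bound `r / 2 ≤ r'` lets the same radius enclose the support of the bump `χ` of
`exists_smooth_step`. -/
theorem IsTest.exists_eq_zero {E : Type} [NormedAddCommGroup E] [NormedSpace ℝ E]
    {g : E → ℝ} {z₀ : E} {r : ℝ} (hr : 0 < r) (hg : IsTest (Metric.ball z₀ r) g) :
    ∃ r' < r, r / 2 ≤ r' ∧ ∀ z ∉ Metric.closedBall z₀ r', g z = 0 := by
  obtain ⟨s, hs, hsub⟩ : ∃ s < r, tsupport g ⊆ Metric.closedBall z₀ s := by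
    rcases (tsupport g).eq_empty_or_nonempty with h | h
    · exact ⟨0, hr, by simp [h]⟩
    · obtain ⟨z, hz, hmax⟩ := hg.2.isCompact.exists_isMaxOn h
        (f := fun z => dist z z₀) (by fun_prop)
      exact ⟨dist z z₀, hg.3 hz, fun w hw => hmax hw⟩
  refine ⟨max s (r / 2), max_lt hs (half_lt_self hr), le_max_right _ _, fun z hz => ?_⟩
  exact image_eq_zero_of_notMem_tsupport fun h =>
    hz (Metric.closedBall_subset_closedBall (le_max_left _ _) (hsub h))

/-- `χ` is the bump of integral one and `X` its primitive, used to cut off `x`-primitives of test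
functions. -/
theorem exists_smooth_step (x₀ : ℝ) {r : ℝ} (hr : 0 < r) :
    ∃ X χ : ℝ → ℝ, ContDiff ℝ ∞ X ∧ ContDiff ℝ ∞ χ ∧ (∀ x, HasDerivAt X (χ x) x) ∧
      (∀ x ≤ x₀ - r / 2, X x = 0) ∧ (∀ x, x₀ + r / 2 ≤ x → X x = 1) ∧
      ∀ x ∉ Metric.closedBall x₀ (r / 2), χ x = 0 := by
  set X : ℝ → ℝ := fun x => Real.smoothTransition ((x - x₀) / r + 1 / 2) with hXdef
  have hX : ContDiff ℝ ∞ X := Real.smoothTransition.contDiff.comp (by fun_prop)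
  have h0 : ∀ x ≤ x₀ - r / 2, X x = 0 := fun x hx => by
    refine Real.smoothTransition.zero_of_nonpos ?_
    have : (x - x₀) / r ≤ -(1 / 2) := by rw [div_le_iff₀ hr]; linarith
    linarith
  have h1 : ∀ x, x₀ + r / 2 ≤ x → X x = 1 := fun x hx => by
    refine Real.smoothTransition.one_of_one_le ?_
    have : 1 / 2 ≤ (x - x₀) / r := by rw [le_div_iff₀ hr]; linarith
    linarith
  refine ⟨X, deriv X, hX, ?_, fun x => (hX.differentiable (by simp) x).hasDerivAt, h0, h1,
    fun x hx => ?_⟩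
  · exact (contDiff_infty_iff_deriv.1 hX).2
  · rw [Metric.mem_closedBall, Real.dist_eq, not_le, lt_abs] at hx
    rcases hx with hx | hx
    · have h2 : X =ᶠ[𝓝 x] fun _ => 1 := by
        filter_upwards [lt_mem_nhds (show x₀ + r / 2 < x by linarith)] with y hy
        exact h1 y hy.le
      rw [h2.deriv_eq, deriv_const]
    · have h2 : X =ᶠ[𝓝 x] fun _ => 0 := by
        filter_upwards [gt_mem_nhds (show x < x₀ - r / 2 by linarith)] with y hy
        exact h0 y hy.le
      rw [h2.deriv_eq, deriv_const]

/-- Fubini: the support of `φ` lies in the ball, so its full `x`-integral is the primitive from `x₀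
- r` evaluated at `x₀ + r`. -/
theorem integral_mul_fst {t₀ x₀ r : ℝ} {φ : ℝ × ℝ → ℝ}
    (hφ : IsTest (Metric.ball (t₀, x₀) r) φ) {e : ℝ → ℝ}
    (he : ContinuousOn e (Metric.ball t₀ r)) :
    ∫ z, φ z * e z.1 = ∫ t, xPrim (x₀ - r) φ (t, x₀ + r) * e t := by
  have hint : Integrable (fun z : ℝ × ℝ => φ z * e z.1) := by
    refine hφ.integrable_mul (ContinuousOn.locallyIntegrableOn ?_ Metric.isOpen_ball.measurableSet)
    refine he.comp continuousOn_fst fun z hz => ?_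
    rw [← ball_prod_same] at hz
    exact hz.1
  rw [Measure.volume_eq_prod] at hint ⊢
  rw [integral_prod _ hint]
  congr 1
  funext t
  simp only
  rw [integral_mul_const]
  congr 1
  refine (intervalIntegral.integral_eq_integral_of_support_subset fun y hy => ?_).symm
  by_contra h
  refine hy (hφ.eq_zero fun hz => h ?_)
  rw [← ball_prod_same] at hz
  have h2 := hz.2
  simp only [Real.ball_eq_Ioo] at h2
  exact ⟨h2.1, h2.2.le⟩

/-- A functional that vanishes on the derivatives `η_x` is determined by its values at the
products `m(t) χ(x)`, for one function `χ` of integral one. -/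
theorem eq_integral_of_xPartial_eq_zero {t₀ x₀ r : ℝ} (hr : 0 < r) {X χ : ℝ → ℝ}
    (hX : ContDiff ℝ ∞ X) (hχ : ContDiff ℝ ∞ χ) (hXχ : ∀ x, HasDerivAt X (χ x) x)
    (hX0 : ∀ x ≤ x₀ - r / 2, X x = 0) (hX1 : ∀ x, x₀ + r / 2 ≤ x → X x = 1)
    (hχ0 : ∀ x ∉ Metric.closedBall x₀ (r / 2), χ x = 0) {Z : (ℝ × ℝ → ℝ) → ℝ}
    (hadd : ∀ g h, IsTest (Metric.ball (t₀, x₀) r) g → IsTest (Metric.ball (t₀, x₀) r) h →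
      Z (fun z => g z + h z) = Z g + Z h)
    (hZ : ∀ η, IsTest (Metric.ball (t₀, x₀) r) η → Z (xPartial η) = 0) {e : ℝ → ℝ}
    (hZχ : ∀ m, IsTest (Metric.ball t₀ r) m →
      Z (fun z => m z.1 * χ z.2) = ∫ t, m t * e t)
    (he : ContinuousOn e (Metric.ball t₀ r)) {φ : ℝ × ℝ → ℝ}
    (hφ : IsTest (Metric.ball (t₀, x₀) r) φ) : Z φ = ∫ z, φ z * e z.1 := by
  obtain ⟨r', hr', hrr', hφ0⟩ := hφ.exists_eq_zero hr
  set P := xPrim (x₀ - r) φ with hP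
  have hPs : ContDiff ℝ ∞ P := contDiff_xPrim (n := ⊤) _ hφ.1
  set m : ℝ → ℝ := fun t => P (t, x₀ + r) with hm
  have hms : ContDiff ℝ ∞ m := hPs.comp (by fun_prop)
  have hφt : ∀ t ∉ Metric.closedBall t₀ r', ∀ x, φ (t, x) = 0 := fun t ht x =>
    hφ0 _ fun h => ht (by rw [← closedBall_prod_same] at h; exact h.1)
  have hφx : ∀ x, r' < |x - x₀| → ∀ t, φ (t, x) = 0 := fun x hx t =>
    hφ0 _ fun h => by
      rw [← closedBall_prod_same] at h
      exact absurd h.2 (by simpa [Real.dist_eq] using hx)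
  have hPt : ∀ t ∉ Metric.closedBall t₀ r', ∀ x, P (t, x) = 0 := fun t ht x => by
    simp [hP, xPrim, hφt t ht]
  have hmt : IsTest (Metric.ball t₀ r) m :=
    isTest_ball_of_eq_zero hms hr' fun t ht => hPt t ht _
  have hPlow : ∀ t, ∀ x < x₀ - r', P (t, x) = 0 := by
    intro t x hx
    have h1 : P (t, x) = ∫ y in (x₀ - r)..x, (0 : ℝ) := by
      refine intervalIntegral.integral_congr fun y hy => hφx y ?_ t
      have h2 : y < x₀ - r' := by
        rcases mem_uIcc.1 hy with h | h <;> linarith [h.1, h.2]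
      exact lt_abs.2 (Or.inr (by linarith))
    simpa using h1
  have hPhigh : ∀ t x, x₀ + r' < x → P (t, x) = m t := by
    intro t x hx
    have hc : Continuous fun y => φ (t, y) := hφ.1.continuous.comp (by fun_prop)
    have h1 : P (t, x) - m t = ∫ y in (x₀ + r)..x, (0 : ℝ) := by
      rw [hm, hP]
      simp only [xPrim]
      rw [intervalIntegral.integral_interval_sub_left (hc.intervalIntegrable _ _)
        (hc.intervalIntegrable _ _)]
      refine intervalIntegral.integral_congr fun y hy => hφx y ?_ t
      have h2 : x₀ + r' < y := by
        rcases mem_uIcc.1 hy with h | h <;> linarith [h.1, h.2]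
      exact lt_abs.2 (Or.inl (by linarith))
    simpa [sub_eq_zero] using h1
  -- To the right of the support of `φ`, the primitive `P` equals `m(t)` instead of zero.
  -- Subtracting `m X` restores compact support, and `η_x = φ - m χ`.
  set η : ℝ × ℝ → ℝ := fun z => P z - m z.1 * X z.2 with hη
  have hηs : ContDiff ℝ ∞ η :=
    hPs.sub ((hms.comp contDiff_fst).mul (hX.comp contDiff_snd))
  have hηt : IsTest (Metric.ball (t₀, x₀) r) η := by
    refine isTest_ball_of_eq_zero hηs hr' ?_
    rintro ⟨t, x⟩ hz
    rw [← closedBall_prod_same] at hz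
    by_cases ht : t ∈ Metric.closedBall t₀ r'
    · have hx : r' < |x - x₀| := by
        by_contra h
        exact hz ⟨ht, by simpa [Real.dist_eq] using h⟩
      rcases lt_abs.1 hx with hx | hx
      · simp [hη, hPhigh t x (by linarith), hX1 x (by linarith)]
      · simp [hη, hPlow t x (by linarith), hX0 x (by linarith)]
    · simp [hη, hPt t ht, hm]
  have hmχ : IsTest (Metric.ball (t₀, x₀) r) fun z => m z.1 * χ z.2 := by
    refine isTest_ball_of_eq_zero ((hms.comp contDiff_fst).mul (hχ.comp contDiff_snd)) hr' ?_
    rintro ⟨t, x⟩ hz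
    rw [← closedBall_prod_same] at hz
    by_cases ht : t ∈ Metric.closedBall t₀ r'
    · rw [hχ0 x fun h => hz ⟨ht, Metric.closedBall_subset_closedBall hrr' h⟩, mul_zero]
    · simp [hPt t ht, hm]
  have hdec : φ = fun z => xPartial η z + m z.1 * χ z.2 := by
    funext ⟨t, x⟩
    have h1 : HasDerivAt (fun x => η (t, x)) (φ (t, x) - m t * χ x) x :=
      (hasDerivAt_xPrim _ hφ.1.continuous t x).sub ((hXχ x).const_mul (m t))
    rw [(hasDerivAt_xPartial hηs t x).unique h1]
    ring
  rw [integral_mul_fst hφ he]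
  conv_lhs => rw [hdec]
  rw [hadd _ _ hηt.xPartial hmχ, hZ _ hηt, zero_add, hZχ m hmt]

/-- Integration by parts on each line `t = const`, with no boundary terms since `η` has compact
support. For `q = 0` the primitive `H` is only continuous in `t`, so no `t`-derivative may be used.
-/
theorem integral_xPartial_mul {V : Set (ℝ × ℝ)} {η H G : ℝ × ℝ → ℝ} (hη : IsTest V η)
    (hH : Continuous H) (hG : Continuous G)
    (hHG : ∀ t x, HasDerivAt (fun x => H (t, x)) (G (t, x)) x) :
    ∫ z, xPartial η z * H z = -∫ z, η z * G z := by
  have hi1 := hη.xPartial.integrable_mul (hH.locallyIntegrable.locallyIntegrableOn V)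
  have hi2 := hη.integrable_mul (hG.locallyIntegrable.locallyIntegrableOn V)
  rw [eq_neg_iff_add_eq_zero, ← integral_add hi1 hi2]
  have hi : Integrable fun z => xPartial η z * H z + η z * G z := hi1.add hi2
  rw [Measure.volume_eq_prod] at hi ⊢
  rw [integral_prod _ hi]
  refine integral_eq_zero_of_ae (Eventually.of_forall fun t => ?_)
  have hd : ∀ x, HasDerivAt (fun x => η (t, x) * H (t, x))
      (xPartial η (t, x) * H (t, x) + η (t, x) * G (t, x)) x := fun x =>
    (hasDerivAt_xPartial hη.1 t x).mul (hHG t x)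
  have hK := (hη.2.isCompact.image continuous_snd).union
    (hη.xPartial.2.isCompact.image continuous_snd)
  have h0 : ∀ x ∉ Prod.snd '' tsupport η ∪ Prod.snd '' tsupport (xPartial η),
      η (t, x) = 0 ∧ xPartial η (t, x) = 0 := fun x hx =>
    ⟨image_eq_zero_of_notMem_tsupport fun h => hx (Or.inl ⟨_, h, rfl⟩),
      image_eq_zero_of_notMem_tsupport fun h => hx (Or.inr ⟨_, h, rfl⟩)⟩
  have hc : Continuous fun x : ℝ => (t, x) := by fun_prop
  have hcη := hη.1.continuous.comp hc
  have hcη' := hη.xPartial.1.continuous.comp hc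
  refine integral_eq_zero_of_hasDerivAt_of_integrable hd ?_ ?_
  · exact ((hcη'.mul (hH.comp hc)).add (hcη.mul (hG.comp hc))).integrable_of_hasCompactSupport
      (HasCompactSupport.intro hK fun x hx => by simp [h0 x hx])
  · exact (hcη.mul (hH.comp hc)).integrable_of_hasCompactSupport
      (HasCompactSupport.intro hK fun x hx => by simp [h0 x hx])

end Constancy

/-! ### Local representation of solutions of systems -/

section Local

variable {Ω : Opens (ℝ × ℝ)}

theorem IsDistrSolution.evalAt_xPartial {p : ℕ} {A : ℝ × ℝ → Matrix (Fin p) (Fin p) ℝ}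
    {hA : ∀ i j, ContDiffOn ℝ ∞ (fun z => A z i j) Ω} {F : ℝ × ℝ → Fin p → ℝ}
    {v : Fin p → 𝓓'(Ω, ℝ)} (hv : IsDistrSolution hA F v) (hF : ContinuousOn F Ω)
    (i : Fin p) {g : ℝ × ℝ → ℝ} (hg : IsTest (Ω : Set (ℝ × ℝ)) g) :
    evalAt (v i) (xPartial g) =
      -(∑ j, evalAt (v j) (fun z => g z * A z i j) + ∫ z, g z * F z i) := by
  have hFi : ContinuousOn (fun z => F z i) Ω := (continuousOn_pi.1 hF) i
  have h1 := congrArg (fun u => evalAt u g) (hv i)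
  rw [evalAt_xDerivDistr _ hg, evalAt_distr_add, evalAt_distr_sum,
    evalAt_regularDistr (hFi.locallyIntegrableOn Ω.isOpen.measurableSet) hg] at h1
  simp only [evalAt_mulDistr _ _ hg] at h1
  rw [← h1, neg_neg]

/-- If `Ψ_x = -Ψ A` on `V`, then `Ψ v` satisfies `(Ψ v)_x = Ψ F` on `V`. -/
theorem IsDistrSolution.sum_evalAt_xPartial {p : ℕ} {A : ℝ × ℝ → Matrix (Fin p) (Fin p) ℝ}
    {hA : ∀ i j, ContDiffOn ℝ ∞ (fun z => A z i j) Ω} {F : ℝ × ℝ → Fin p → ℝ}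
    {v : Fin p → 𝓓'(Ω, ℝ)} (hv : IsDistrSolution hA F v) (hF : ContinuousOn F Ω)
    {V : Set (ℝ × ℝ)} (hV : V ⊆ Ω) {Ψ : ℝ × ℝ → Matrix (Fin p) (Fin p) ℝ}
    (hΨ : ∀ i j, ContDiff ℝ ∞ fun z => Ψ z i j)
    (hΨx : ∀ z ∈ V, ∀ i j, HasDerivAt (fun x => Ψ (z.1, x) i j) (-(Ψ z * A z) i j) z.2)
    (i : Fin p) {g : ℝ × ℝ → ℝ} (hg : IsTest V g) :
    ∑ j, evalAt (v j) (fun z => Ψ z i j * xPartial g z) =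
      -∫ z, g z * (Ψ z *ᵥ F z) i := by
  have hgΨ : ∀ j, IsTest (Ω : Set (ℝ × ℝ)) fun z => Ψ z i j * g z := fun j =>
    (hg.mono hV).mul_left (hΨ i j)
  have hgA : ∀ j k, IsTest (Ω : Set (ℝ × ℝ)) fun z => Ψ z i j * g z * A z j k := fun j k =>
    (hgΨ j).mul_contDiffOn Ω.isOpen (hA j k) subset_rfl
  -- Product rule with `Ψ_x = -Ψ A`: `Ψ g_x = (Ψ g)_x + (Ψ A) g` on `V`; off `V` every term vanishes
  -- with `g`.
  have hfun : ∀ j, (fun z => Ψ z i j * xPartial g z) =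
      fun z => xPartial (fun z => Ψ z i j * g z) z + ∑ k, Ψ z i k * g z * A z k j := by
    intro j
    funext ⟨t, x⟩
    have h1 := hasDerivAt_xPartial (hgΨ j).1 t x
    by_cases hz : (t, x) ∈ V
    · have h2 := (hΨx _ hz i j).mul (hasDerivAt_xPartial hg.1 t x)
      rw [h1.unique h2, Matrix.mul_apply]
      have h3 : ∑ k, Ψ (t, x) i k * g (t, x) * A (t, x) k j =
          (∑ k, Ψ (t, x) i k * A (t, x) k j) * g (t, x) := by
        rw [Finset.sum_mul]
        exact Finset.sum_congr rfl fun k _ => by ring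
      rw [h3]
      ring
    · have h2 := hg.xPartial.eq_zero hz
      have h3 : xPartial (fun z => Ψ z i j * g z) (t, x) = 0 :=
        (hg.mul_left (hΨ i j)).xPartial.eq_zero hz
      simp [h2, h3, hg.eq_zero hz]
  have hev : ∀ j, evalAt (v j) (fun z => Ψ z i j * xPartial g z) =
      -(∑ k, evalAt (v k) (fun z => Ψ z i j * g z * A z j k) + ∫ z, Ψ z i j * g z * F z j) +
        ∑ k, evalAt (v j) (fun z => Ψ z i k * g z * A z k j) := by
    intro j
    rw [hfun j, evalAt_add _ (hgΨ j).xPartial (IsTest.sum fun k _ => hgA k j),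
      evalAt_sum _ fun k _ => hgA k j, hv.evalAt_xPartial hF j (hgΨ j)]
  have hint : ∫ z, g z * (Ψ z *ᵥ F z) i = ∑ j, ∫ z, Ψ z i j * g z * F z j := by
    rw [← integral_finsetSum]
    · congr 1
      funext z
      rw [Matrix.mulVec, dotProduct, Finset.mul_sum]
      exact Finset.sum_congr rfl fun j _ => by ring
    · exact fun j _ => (hgΨ j).integrable_mul
        (((continuousOn_pi.1 hF) j).locallyIntegrableOn Ω.isOpen.measurableSet)
  simp only [hev, hint, Finset.sum_add_distrib, Finset.sum_neg_distrib, neg_add]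
  -- The double sum from the equation and the one from `Ψ_x` cancel once their indices are
  -- exchanged.
  rw [Finset.sum_comm]
  ring

/-- The pairing of a semiregular distribution with `m(t) B(t, x)`, where `B` is a fixed smooth
function, is given by a function of `t` of the same regularity. -/
theorem IsSemiregular.exists_contDiffOn {q : ℕ∞} {u : 𝓓'(Ω, ℝ)} (hu : IsSemiregular q u)
    {t₀ x₀ r r' : ℝ} (hball : Metric.ball (t₀, x₀) r ⊆ Ω) (hr' : r' < r) {B : ℝ × ℝ → ℝ}
    (hB : ContDiff ℝ ∞ B) (hB0 : ∀ t, ∀ x ∉ Metric.closedBall x₀ r', B (t, x) = 0) :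
    ∃ c : ℝ → ℝ, ContDiffOn ℝ q c (Metric.ball t₀ r) ∧
      ∀ m, IsTest (Metric.ball t₀ r) m →
        evalAt u (fun z => m z.1 * B z) = ∫ t, m t * c t := by
  let I : Opens ℝ := ⟨Metric.ball t₀ r, Metric.isOpen_ball⟩
  let J : Opens ℝ := ⟨Metric.ball x₀ r, Metric.isOpen_ball⟩
  have hrect : (rect I J : Set (ℝ × ℝ)) = Metric.ball (t₀, x₀) r := ball_prod_same t₀ x₀ r
  have hle : rect I J ≤ Ω := fun z hz => hball (by rw [← hrect]; exact hz)
  obtain ⟨U, hU, hgiven⟩ := hu I J (convex_ball t₀ r).ordConnected (convex_ball x₀ r).ordConnected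
    hle
  let K : Compacts ℝ := ⟨Metric.closedBall x₀ r', isCompact_closedBall x₀ r'⟩
  have hKJ : (K : Set ℝ) ⊆ J := Metric.closedBall_subset_ball hr'
  -- The witness is `c(t) = ⟨U(t), B(t, ·)⟩`.
  refine ⟨fun t => U t (sliceOn hKJ hB hB0 t), hU.contDiffOn_apply_sliceOn hKJ hB hB0,
    fun m hm => ?_⟩
  have hg : IsTest (rect I J : Set (ℝ × ℝ)) fun z => m z.1 * B z := by
    have h0 : ∀ z ∉ tsupport m ×ˢ Metric.closedBall x₀ r', m z.1 * B z = 0 := by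
      rintro ⟨t, x⟩ hz
      by_cases ht : t ∈ tsupport m
      · rw [hB0 t x fun h => hz ⟨ht, h⟩, mul_zero]
      · simp [image_eq_zero_of_notMem_tsupport ht]
    have hc : IsCompact (tsupport m ×ˢ Metric.closedBall x₀ r') :=
      hm.2.isCompact.prod (isCompact_closedBall x₀ r')
    exact ⟨(hm.1.comp contDiff_fst).mul hB, HasCompactSupport.intro hc h0,
      (closure_minimal (Function.support_subset_iff'.2 h0) hc.isClosed).trans
        (prod_mono hm.3 hKJ)⟩
  rw [← evalAt_restrictDistr hle u hg, evalAt_eq _ hg, hgiven]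
  -- On a slice `m(t)` is a constant, so linearity of `U t` takes it out.
  have hslice : ∀ t, sliceTest hg.toTest t = m t • sliceOn hKJ hB hB0 t := fun t => rfl
  simp only [hslice, map_smul, smul_eq_mul]
  refine setIntegral_eq_integral_of_forall_compl_eq_zero fun t ht => ?_
  rw [hm.eq_zero ht, zero_mul]

end Local

/-! ### Local and global classical representatives for systems. -/

section LocalRepresentation

variable {Ω : Opens (ℝ × ℝ)}

theorem integral_fst_mul {t₀ x₀ r r' : ℝ} (hr' : r' < r) {m : ℝ → ℝ}
    (hm : IsTest (Metric.ball t₀ r) m) {B : ℝ × ℝ → ℝ} (hB : Continuous B)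
    (hB0 : ∀ t, ∀ x ∉ Metric.closedBall x₀ r', B (t, x) = 0) :
    ∫ z, m z.1 * B z = ∫ t, m t * xPrim (x₀ - r) B (t, x₀ + r) := by
  have hint : Integrable fun z : ℝ × ℝ => m z.1 * B z := by
    refine Continuous.integrable_of_hasCompactSupport
      ((hm.1.continuous.comp continuous_fst).mul hB)
      (HasCompactSupport.intro (hm.2.isCompact.prod (isCompact_closedBall x₀ r')) ?_)
    rintro ⟨t, x⟩ hz
    by_cases ht : t ∈ tsupport m
    · rw [hB0 t x fun h => hz ⟨ht, h⟩, mul_zero]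
    · simp [image_eq_zero_of_notMem_tsupport ht]
  rw [Measure.volume_eq_prod] at hint ⊢
  rw [integral_prod _ hint]
  congr 1
  funext t
  simp only
  rw [integral_const_mul]
  congr 1
  refine (intervalIntegral.integral_eq_integral_of_support_subset fun y hy => ?_).symm
  by_contra h
  refine hy (hB0 t y fun hy' => h ?_)
  have h2 := Metric.closedBall_subset_ball hr' hy'
  rw [Real.ball_eq_Ioo] at h2
  exact ⟨h2.1, h2.2.le⟩

/-- Near every point, a semiregular solution of a system is given by a classical solution. -/
theorem IsDistrSolution.exists_local_representation {q : ℕ∞} {p : ℕ}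
    {A : ℝ × ℝ → Matrix (Fin p) (Fin p) ℝ} {hA : ∀ i j, ContDiffOn ℝ ∞ (fun z => A z i j) Ω}
    {F : ℝ × ℝ → Fin p → ℝ} {v : Fin p → 𝓓'(Ω, ℝ)} (hv : IsDistrSolution hA F v)
    (hF : ContDiffOn ℝ q F Ω) (hsr : ∀ i, IsSemiregular q (v i)) {z₀ : ℝ × ℝ} (hz₀ : z₀ ∈ Ω) :
    ∃ r > 0, Metric.ball z₀ r ⊆ Ω ∧ ∃ ψ : ℝ × ℝ → Fin p → ℝ,
      ContDiffOn ℝ q ψ (Metric.ball z₀ r) ∧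
      (∀ z ∈ Metric.ball z₀ r,
        HasDerivAt (fun x => ψ (z.1, x)) (A z *ᵥ ψ z + F z) z.2) ∧
      ∀ i, Represents (v i) (Metric.ball z₀ r) fun z => ψ z i := by
  obtain ⟨t₀, x₀⟩ := z₀
  obtain ⟨r₁, hr₁, hsub⟩ := Metric.nhds_basis_closedBall.mem_iff.1 (Ω.isOpen.mem_nhds hz₀)
  let K : Compacts (ℝ × ℝ) := ⟨Metric.closedBall (t₀, x₀) r₁, isCompact_closedBall _ _⟩
  have hK : (K : Set (ℝ × ℝ)) ⊆ Ω := hsub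
  choose A' hA' hAA' using fun i j => exists_contDiff_eqOn (hA i j) hK
  choose F' hF' hFF' using fun i =>
    exists_contDiff_eqOn_of_contDiffOn ((contDiffOn_pi.1 hF) i) hK
  obtain ⟨r₂, hr₂, Ψ, Θ, hΨ, hΘ, hfund⟩ :=
    exists_fundamental_matrix (A := fun z => Matrix.of fun i j => A' i j z) hA' (t₀, x₀)
  set r := min r₁ r₂ with hrdef
  have hr : 0 < r := lt_min hr₁ hr₂
  set V := Metric.ball (t₀, x₀) r with hVdef
  have hVK : V ⊆ K := (Metric.ball_subset_ball (min_le_left _ _)).trans Metric.ball_subset_closedBall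
  have hV₂ : V ⊆ Metric.ball (t₀, x₀) r₂ := Metric.ball_subset_ball (min_le_right _ _)
  have hVΩ : V ⊆ Ω := hVK.trans hK
  have hAV : ∀ z ∈ V, (Matrix.of fun i j => A' i j z) = A z := fun z hz => by
    ext i j
    exact hAA' i j (hVK hz)
  have hFV : ∀ z ∈ V, (fun i => F' i z) = F z := fun z hz => by
    funext i
    exact hFF' i (hVK hz)
  have hΨx : ∀ z ∈ V, ∀ i j, HasDerivAt (fun x => Ψ (z.1, x) i j) (-(Ψ z * A z) i j) z.2 :=
    fun z hz i j => by
      rw [← hAV z hz]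
      exact (hfund z (hV₂ hz)).2.1 i j
  have hΘx : ∀ z ∈ V, ∀ i j, HasDerivAt (fun x => Θ (z.1, x) i j) ((A z * Θ z) i j) z.2 :=
    fun z hz i j => by
      rw [← hAV z hz]
      exact (hfund z (hV₂ hz)).2.2 i j
  have hq : (q : ℕ∞ω) ≤ ∞ := by exact_mod_cast le_top
  obtain ⟨X, χ, hX, hχ, hXχ, hX0, hX1, hχ0⟩ := exists_smooth_step x₀ hr
  set G : Fin p → ℝ × ℝ → ℝ := fun i z => ∑ j, Ψ z i j * F' j z with hGdef
  have hG : ∀ i, ContDiff ℝ q (G i) := fun i =>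
    ContDiff.sum fun j _ => ((hΨ i j).of_le hq).mul (hF' j)
  have hGV : ∀ z ∈ V, ∀ i, G i z = (Ψ z *ᵥ F z) i := fun z hz i => by
    rw [← hFV z hz]
    rfl
  set H : Fin p → ℝ × ℝ → ℝ := fun i => xPrim x₀ (G i) with hHdef
  have hH : ∀ i, ContDiff ℝ q (H i) := fun i => contDiff_xPrim x₀ (hG i)
  have hHx : ∀ i t x, HasDerivAt (fun x => H i (t, x)) (G i (t, x)) x := fun i t x =>
    hasDerivAt_xPrim x₀ (hG i).continuous t x
  choose c hc hcm using fun i j => (hsr j).exists_contDiffOn hVΩ (half_lt_self hr)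
    (B := fun z => χ z.2 * Ψ z i j) ((hχ.comp contDiff_snd).mul (hΨ i j))
    (fun t x hx => by simp [hχ0 x hx])
  set h : Fin p → ℝ → ℝ := fun i t => xPrim (x₀ - r) (fun z => χ z.2 * H i z) (t, x₀ + r)
    with hhdef
  have hχH : ∀ i, ContDiff ℝ q fun z : ℝ × ℝ => χ z.2 * H i z := fun i =>
    ((hχ.of_le hq).comp contDiff_snd).mul (hH i)
  have hh : ∀ i, ContDiff ℝ q (h i) := fun i =>
    (contDiff_xPrim _ (hχH i)).comp (contDiff_id.prodMk contDiff_const)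
  -- The density in `t` of the pairing of `Ψ v - H` with `m(t) χ(x)`: `c` comes from `Ψ v` and `h`
  -- from `H`.
  set e : Fin p → ℝ → ℝ := fun i t => ∑ j, c i j t - h i t with hedef
  have he : ∀ i, ContDiffOn ℝ q (e i) (Metric.ball t₀ r) := fun i =>
    (ContDiffOn.sum fun j _ => hc i j).sub (hh i).contDiffOn
  set w : Fin p → ℝ × ℝ → ℝ := fun i z => e i z.1 + H i z with hwdef
  have hw : ∀ i, ContDiffOn ℝ q (w i) V := fun i =>
    ((he i).comp contDiffOn_fst fun z hz => by
      rw [hVdef, ← ball_prod_same] at hz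
      exact hz.1).add (hH i).contDiffOn
  have hloc : ∀ {f : ℝ × ℝ → ℝ}, ContinuousOn f V → LocallyIntegrableOn f V volume :=
    fun hf => hf.locallyIntegrableOn Metric.isOpen_ball.measurableSet
  have htest : ∀ {g : ℝ × ℝ → ℝ}, IsTest V g → ∀ i j,
      IsTest (Ω : Set (ℝ × ℝ)) fun z => Ψ z i j * g z := fun hg i j =>
    (hg.mono hVΩ).mul_left (hΨ i j)
  have hHi : ∀ {g : ℝ × ℝ → ℝ}, IsTest V g → ∀ i, Integrable fun z => g z * H i z :=
    fun hg i => hg.integrable_mul (hloc (hH i).continuous.continuousOn)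
  have hW : ∀ i g, IsTest V g →
      ∑ j, evalAt (v j) (fun z => Ψ z i j * g z) = ∫ z, g z * w i z := by
    intro i g hg
    -- The functional `Z` is row `i` of `Ψ v - H`, which vanishes on `x`-derivatives and is thus the
    -- function `e i` of `t`.
    have hkey := eq_integral_of_xPartial_eq_zero hr hX hχ hXχ hX0 hX1 hχ0 (e := e i)
      (Z := fun g => ∑ j, evalAt (v j) (fun z => Ψ z i j * g z) - ∫ z, g z * H i z)
      (fun g g' hg hg' => ?_) (fun η hη => ?_) (fun m hm => ?_) (he i).continuousOn hg
    · have h1 : ∫ z, g z * w i z = (∫ z, g z * e i z.1) + ∫ z, g z * H i z := by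
        rw [← integral_add _ (hHi hg i)]
        · simp only [hwdef, mul_add]
        · refine hg.integrable_mul (hloc ((he i).continuousOn.comp continuousOn_fst fun z hz => ?_))
          rw [hVdef, ← ball_prod_same] at hz
          exact hz.1
      rw [h1, ← hkey, sub_add_cancel]
    · simp only [mul_add, add_mul]
      rw [integral_add (hHi hg i) (hHi hg' i)]
      simp only [evalAt_add _ (htest hg i _) (htest hg' i _), Finset.sum_add_distrib]
      ring
    · rw [hv.sum_evalAt_xPartial hF.continuousOn hVΩ hΨ hΨx i hη,
        integral_xPartial_mul hη (hH i).continuous (hG i).continuous (hHx i)]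
      have h1 : ∀ z, η z * (Ψ z *ᵥ F z) i = η z * G i z := fun z => by
        by_cases hz : z ∈ V
        · rw [hGV z hz]
        · simp [hη.eq_zero hz]
      simp only [h1, sub_self]
    · have h1 : ∀ j, evalAt (v j) (fun z => Ψ z i j * (m z.1 * χ z.2)) = ∫ t, m t * c i j t := by
        intro j
        rw [← hcm i j m hm]
        congr 1
        funext z
        ring
      have h2 : ∫ z : ℝ × ℝ, m z.1 * χ z.2 * H i z = ∫ t, m t * h i t := by
        simp only [mul_assoc]
        exact integral_fst_mul (half_lt_self hr) hm (hχH i).continuous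
          fun t x hx => by simp [hχ0 x hx]
      have h3 : ∀ {f : ℝ → ℝ}, ContinuousOn f (Metric.ball t₀ r) →
          Integrable fun t => m t * f t := fun hf =>
        hm.integrable_mul (hf.locallyIntegrableOn Metric.isOpen_ball.measurableSet)
      simp only [h1, h2]
      rw [← integral_finsetSum _ fun j _ => h3 (hc i j).continuousOn, ← integral_sub
        (integrable_finsetSum _ fun j _ => h3 (hc i j).continuousOn)
        (h3 (hh i).continuous.continuousOn)]
      simp only [hedef, mul_sub, Finset.mul_sum]
  refine ⟨r, hr, hVΩ, fun z => Θ z *ᵥ fun i => w i z, ?_, fun z hz => ?_, fun k g hg => ?_⟩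
  · refine contDiffOn_pi.2 fun k => ?_
    have h1 : ContDiffOn ℝ q (fun z => ∑ i, Θ z k i * w i z) V :=
      ContDiffOn.sum fun i _ => ((hΘ k i).of_le hq).contDiffOn.mul (hw i)
    exact h1
  · refine hasDerivAt_pi.2 fun k => ?_
    have h1 : HasDerivAt (fun x => ∑ i, Θ (z.1, x) k i * w i (z.1, x))
        (∑ i, ((A z * Θ z) k i * w i z + Θ z k i * G i z)) z.2 :=
      HasDerivAt.fun_sum fun i _ => (hΘx z hz k i).mul ((hHx i z.1 z.2).const_add (e i z.1))
    refine h1.congr_deriv ?_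
    -- Variation of constants: `(Θ w)_x = A Θ w + Θ Ψ F`, where `Θ Ψ = 1`.
    have h2 : Θ z *ᵥ (Ψ z *ᵥ F z) = F z := by
      rw [Matrix.mulVec_mulVec, (hfund z (hV₂ hz)).1, Matrix.one_mulVec]
    rw [Pi.add_apply, ← congrFun h2 k, Matrix.mulVec_mulVec, Finset.sum_add_distrib]
    congr 1
    exact Finset.sum_congr rfl fun i _ => by rw [hGV z hz]
  · have hΘg : ∀ i, IsTest V fun z => Θ z k i * g z := fun i => hg.mul_left (hΘ k i)
    have h1 : ∫ z, g z * (Θ z *ᵥ fun i => w i z) k = ∑ i, ∫ z, Θ z k i * g z * w i z := by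
      rw [← integral_finsetSum _ fun i _ => (hΘg i).integrable_mul (hloc (hw i).continuousOn)]
      congr 1
      funext z
      rw [Matrix.mulVec, dotProduct, Finset.mul_sum]
      exact Finset.sum_congr rfl fun i _ => by ring
    -- Testing row `i` of `Ψ v` with `Θ k i * g` and summing over `i` recovers `v k`, because `Θ Ψ =
    -- 1` on `V`.
    have h2 : ∀ j, (fun z => ∑ i, Ψ z i j * (Θ z k i * g z)) =
        fun z => (1 : Matrix (Fin p) (Fin p) ℝ) k j * g z := by
      intro j
      funext z
      by_cases hz : z ∈ V
      · rw [← (hfund z (hV₂ hz)).1, Matrix.mul_apply, Finset.sum_mul]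
        exact Finset.sum_congr rfl fun i _ => by ring
      · simp [hg.eq_zero hz]
    rw [h1]
    simp only [← hW _ _ (hΘg _)]
    rw [Finset.sum_comm]
    simp only [← evalAt_sum _ fun i _ => htest (hΘg i) i _, h2]
    rw [Finset.sum_eq_single k]
    · simp
    · intro j _ hj
      simp only [Matrix.one_apply_ne' hj, zero_mul]
      exact evalAt_zero _
    · simp

/-- A semiregular solution of a system is given by a classical solution. -/
theorem IsDistrSolution.exists_classical {q : ℕ∞} {p : ℕ}
    {A : ℝ × ℝ → Matrix (Fin p) (Fin p) ℝ} {hA : ∀ i j, ContDiffOn ℝ ∞ (fun z => A z i j) Ω}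
    {F : ℝ × ℝ → Fin p → ℝ} {v : Fin p → 𝓓'(Ω, ℝ)} (hv : IsDistrSolution hA F v)
    (hF : ContDiffOn ℝ q F Ω) (hsr : ∀ i, IsSemiregular q (v i)) :
    ∃ ψ : ℝ × ℝ → Fin p → ℝ, ContDiffOn ℝ q ψ Ω ∧
      (∀ z ∈ Ω, HasDerivAt (fun x => ψ (z.1, x)) (A z *ᵥ ψ z + F z) z.2) ∧
      ∀ i, v i = regularDistr Ω fun z => ψ z i := by
  -- One radius and one vector function per point serve all components, so componentwise gluing
  -- gives a single vector function.
  choose! r hr hsub ψ hψ hd hrep using fun (z : ℝ × ℝ) (hz : z ∈ Ω) =>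
    hv.exists_local_representation hF hsr (z₀ := z) hz
  have hglue : ∀ i, _ := fun i => glue_represents (u := v i) (r := r)
    (ψ := fun z w => ψ z w i) hr hsub
    (fun z hz => (continuousOn_pi.1 (hψ z hz).continuousOn) i) (fun z hz => hrep z hz i)
  have heq : ∀ z ∈ Ω, EqOn (fun w => ψ w w) (ψ z) (Metric.ball z (r z)) := fun z hz w hw => by
    funext i
    exact (hglue i).1 z hz hw
  have hself : ∀ z ∈ Ω, z ∈ Metric.ball z (r z) := fun z hz => Metric.mem_ball_self (hr z hz)
  refine ⟨fun w => ψ w w, fun z hz => ?_, fun z hz => ?_, fun i => (hglue i).2⟩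
  · have hn := Metric.isOpen_ball.mem_nhds (hself z hz)
    exact (((hψ z hz).contDiffAt hn).congr_of_eventuallyEq
      ((heq z hz).eventuallyEq_of_mem hn)).contDiffWithinAt
  · have hc : ContinuousAt (fun x : ℝ => (z.1, x)) z.2 := by fun_prop
    refine (hd z hz z (hself z hz)).congr_of_eventuallyEq ?_
    filter_upwards [hc.eventually (Metric.isOpen_ball.mem_nhds (hself z hz))] with x hx
    exact heq z hz hx

end LocalRepresentation

/-! ### Semiregularity of derivatives -/

theorem IsCurveOfClass.clm_comp {G H : Type*} [AddCommGroup G] [Module ℝ G] [TopologicalSpace G]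
    [AddCommGroup H] [Module ℝ H] [TopologicalSpace H] {q : ℕ∞} {I : Set ℝ} {U : ℝ → G}
    (hU : IsCurveOfClass q I U) (T : G →L[ℝ] H) : IsCurveOfClass q I fun t => T (U t) := by
  obtain ⟨D, rfl, hc, hd⟩ := hU
  refine ⟨fun k t => T (D k t), rfl, fun k hk => T.continuous.comp_continuousOn (hc k hk),
    fun k hk t ht => ?_⟩
  refine ((T.continuous.tendsto _).comp (hd k hk t ht)).congr fun s => ?_
  simp [slope_def_module]

theorem lineDerivOp_sliceTest {I J : Opens ℝ} (φ : 𝓓(rect I J, ℝ)) (t : ℝ) :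
    ∂_{(1 : ℝ)} (sliceTest φ t) = sliceTest (isTest_coe φ).xPartial.toTest t := by
  ext x
  have h1 : (∂_{(1 : ℝ)} (sliceTest φ t)) x = lineDeriv ℝ (sliceTest φ t) x 1 :=
    TestFunction.lineDerivCLM_apply_of_le (𝕜 := ℝ) (by simp)
  rw [h1]
  refine HasDerivAt.deriv ?_
  have h2 : HasDerivAt (fun s : ℝ => x + s • (1 : ℝ)) 1 0 := by
    simpa using (hasDerivAt_id (0 : ℝ)).const_add x
  have h3 := (hasDerivAt_xPartial φ.contDiff t (x + (0 : ℝ) • (1 : ℝ))).comp (0 : ℝ) h2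
  rw [mul_one, zero_smul, add_zero] at h3
  exact h3

/-- Differentiation is a continuous linear operator on `𝓓'(J)`, so it may be applied to the curve;
`x`-derivatives commute with slicing. -/
theorem IsSemiregular.xDerivDistr {q : ℕ∞} {Ω : Opens (ℝ × ℝ)} {u : 𝓓'(Ω, ℝ)}
    (hu : IsSemiregular q u) : IsSemiregular q (xDerivDistr u) := by
  intro I J hI hJ h
  obtain ⟨U, hU, hgiven⟩ := hu I J hI hJ h
  refine ⟨fun t => ∂_{(1 : ℝ)} (U t),
    hU.clm_comp (Distribution.lineDerivCLM (1 : ℝ) : 𝓓'(J, ℝ) →L[ℝ] 𝓓'(J, ℝ)), fun φ => ?_⟩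
  have hφ := isTest_coe φ
  have h1 : ∀ t, (∂_{(1 : ℝ)} (U t)) (sliceTest φ t) = -U t (sliceTest hφ.xPartial.toTest t) := by
    intro t
    rw [← lineDerivOp_sliceTest, ← map_neg]
    exact Distribution.lineDerivOp_apply_apply (U t) (sliceTest φ t) 1
  simp only [h1, integral_neg]
  rw [← hgiven, ← evalAt_eq, evalAt_restrictDistr h u hφ.xPartial, ← evalAt_coe,
    evalAt_restrictDistr h _ hφ, evalAt_xDerivDistr u (hφ.mono h)]

theorem IsSemiregular.iterate_xDerivDistr {q : ℕ∞} {Ω : Opens (ℝ × ℝ)} {u : 𝓓'(Ω, ℝ)}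
    (hu : IsSemiregular q u) (k : ℕ) : IsSemiregular q (ParamODE.xDerivDistr^[k] u) := by
  induction k with
  | zero => exact hu
  | succ k ih =>
    rw [Function.iterate_succ_apply']
    exact ih.xDerivDistr

/-! ### Classical solutions -/

/-- Openness of `Ω` makes identities on `Ω` hold near each point of the line, as iterated
derivatives require. -/
theorem isCx_of_hasDerivAt {G : Type*} [NormedAddCommGroup G] [NormedSpace ℝ G] {p : ℕ}
    {Ω : Set (ℝ × ℝ)} (hΩ : IsOpen Ω) {φ : ℕ → ℝ × ℝ → G}
    (hd : ∀ k < p, ∀ z ∈ Ω, HasDerivAt (fun x => φ k (z.1, x)) (φ (k + 1) z) z.2)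
    (hc : ∀ k ≤ p, ContinuousOn (φ k) Ω) :
    IsCx p Ω (φ 0) ∧ ∀ k ≤ p, ∀ z ∈ Ω, xDeriv k (φ 0) z = φ k z := by
  have hev : ∀ z ∈ Ω, ∀ᶠ x in 𝓝 z.2, (z.1, x) ∈ Ω := fun z hz =>
    (show ContinuousAt (fun x : ℝ => (z.1, x)) z.2 by fun_prop).eventually (hΩ.mem_nhds hz)
  have hx : ∀ k ≤ p, ∀ z ∈ Ω, xDeriv k (φ 0) z = φ k z := by
    intro k
    induction k with
    | zero => exact fun _ z _ => by simp [xDeriv]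
    | succ k ih =>
      intro hk z hz
      rw [xDeriv, iteratedDeriv_succ]
      refine HasDerivAt.deriv ((hd k hk z hz).congr_of_eventuallyEq ?_)
      filter_upwards [hev z hz] with x hx
      exact ih (by omega) (z.1, x) hx
  refine ⟨⟨fun k hk z hz => ?_, fun k hk => (hc k hk).congr (hx k hk)⟩, hx⟩
  refine ((hd k hk z hz).congr_of_eventuallyEq ?_).differentiableAt
  filter_upwards [hev z hz] with x hxz
  exact hx k hk.le (z.1, x) hxz

theorem isClassicalSolution_of_hasDerivAt {p : ℕ} {Ω : Set (ℝ × ℝ)} (hΩ : IsOpen Ω)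
    {A : ℝ × ℝ → Matrix (Fin p) (Fin p) ℝ} (hA : ∀ i j, ContinuousOn (fun z => A z i j) Ω)
    {F ψ : ℝ × ℝ → Fin p → ℝ} (hF : ContinuousOn F Ω) (hψ : ContinuousOn ψ Ω)
    (hd : ∀ z ∈ Ω, HasDerivAt (fun x => ψ (z.1, x)) (A z *ᵥ ψ z + F z) z.2) :
    IsClassicalSolution Ω A F ψ := by
  have hAψ : ContinuousOn (fun z => A z *ᵥ ψ z + F z) Ω := by
    refine ContinuousOn.add (continuousOn_pi.2 fun i => ?_) hF
    have h1 : ContinuousOn (fun z => ∑ j, A z i j * ψ z j) Ω :=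
      continuousOn_finsetSum _ fun j _ => (hA i j).mul ((continuousOn_pi.1 hψ) j)
    exact h1
  have h := isCx_of_hasDerivAt (p := 1) hΩ
    (φ := fun k => if k = 0 then ψ else fun z => A z *ᵥ ψ z + F z)
    (fun k hk z hz => by
      obtain rfl : k = 0 := by omega
      exact hd z hz)
    (fun k _ => by
      by_cases hk : k = 0
      · simpa only [hk, if_true] using hψ
      · simpa only [hk, if_false] using hAψ)
  exact ⟨h.1, fun z hz => h.2 1 le_rfl z hz⟩

/-! ### Scalar equations -/

section Scalar

variable {Ω : Opens (ℝ × ℝ)}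

/-- Testing the equation with `η` divided by the leading coefficient solves it for the top
derivative; this is the last row of the companion system. -/
theorem IsScalarDistrSolution.evalAt_iterate {p : ℕ} {g : Fin (p + 1) → ℝ × ℝ → ℝ}
    {hg : ∀ k, ContDiffOn ℝ ∞ (g k) Ω} {f : ℝ × ℝ → ℝ} {u : 𝓓'(Ω, ℝ)}
    (hu : IsScalarDistrSolution hg f u) (hgp : ∀ z ∈ Ω, g (Fin.last p) z ≠ 0)
    (hf : ContinuousOn f Ω) {η : ℝ × ℝ → ℝ} (hη : IsTest (Ω : Set (ℝ × ℝ)) η) :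
    evalAt (xDerivDistr^[p] u) η =
      ∑ k : Fin p, evalAt (xDerivDistr^[(k : ℕ)] u)
        (fun z => η z * -(g k.castSucc z / g (Fin.last p) z)) +
      ∫ z, η z * (f z / g (Fin.last p) z) := by
  have hinv : ContDiffOn ℝ ∞ (fun z => (g (Fin.last p) z)⁻¹) Ω := (hg _).inv hgp
  have hηg := hη.mul_contDiffOn Ω.isOpen hinv subset_rfl
  have h1 := congrArg (fun u => evalAt u fun z => η z * (g (Fin.last p) z)⁻¹) hu
  simp only [evalAt_distr_sum] at h1
  simp only [evalAt_mulDistr _ _ hηg] at h1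
  simp only [Fin.sum_univ_castSucc, Fin.val_last, Fin.val_castSucc] at h1
  rw [evalAt_regularDistr (hf.locallyIntegrableOn Ω.isOpen.measurableSet) hηg] at h1
  have h2 : (fun z => η z * (g (Fin.last p) z)⁻¹ * g (Fin.last p) z) = η := by
    funext z
    by_cases hz : z ∈ (Ω : Set (ℝ × ℝ))
    · rw [inv_mul_cancel_right₀ (hgp z hz)]
    · simp [hη.eq_zero hz]
  have h3 : ∀ k : Fin p, evalAt (xDerivDistr^[(k : ℕ)] u)
      (fun z => η z * -(g k.castSucc z / g (Fin.last p) z)) =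
      -evalAt (xDerivDistr^[(k : ℕ)] u)
        (fun z => η z * (g (Fin.last p) z)⁻¹ * g k.castSucc z) := by
    intro k
    rw [← evalAt_neg _ (hηg.mul_contDiffOn Ω.isOpen (hg _) subset_rfl)]
    congr 1
    funext z
    ring
  have h4 : ∫ z, η z * (f z / g (Fin.last p) z) = ∫ z, η z * (g (Fin.last p) z)⁻¹ * f z := by
    congr 1
    funext z
    ring
  rw [h2] at h1
  rw [h4, ← h1]
  simp only [h3, Finset.sum_neg_distrib]
  ring

/-- The matrix of the first order system for `(u, u_x, …)`. -/
noncomputable def companion {p : ℕ} (g : Fin (p + 1) → ℝ × ℝ → ℝ) (z : ℝ × ℝ) : Matrix (Fin p) (Fin p) ℝ :=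
  fun i j => if (i : ℕ) + 1 = p then -(g j.castSucc z / g (Fin.last p) z)
    else if (j : ℕ) = i + 1 then 1 else 0

/-- The right-hand side of the first order system for `(u, u_x, …)`. -/
noncomputable def companionRhs {p : ℕ} (g : Fin (p + 1) → ℝ × ℝ → ℝ) (f : ℝ × ℝ → ℝ) (z : ℝ × ℝ) :
    Fin p → ℝ :=
  fun i => if (i : ℕ) + 1 = p then f z / g (Fin.last p) z else 0

theorem contDiffOn_companion {p : ℕ} {g : Fin (p + 1) → ℝ × ℝ → ℝ}
    (hg : ∀ k, ContDiffOn ℝ ∞ (g k) Ω) (hgp : ∀ z ∈ Ω, g (Fin.last p) z ≠ 0) (i j : Fin p) :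
    ContDiffOn ℝ ∞ (fun z => companion g z i j) Ω := by
  unfold companion
  split_ifs
  · exact ((hg _).div (hg _) hgp).neg
  · exact contDiffOn_const
  · exact contDiffOn_const

theorem contDiffOn_companionRhs {q : ℕ∞} {p : ℕ} {g : Fin (p + 1) → ℝ × ℝ → ℝ}
    (hg : ∀ k, ContDiffOn ℝ ∞ (g k) Ω) (hgp : ∀ z ∈ Ω, g (Fin.last p) z ≠ 0)
    {f : ℝ × ℝ → ℝ} (hf : ContDiffOn ℝ q f Ω) : ContDiffOn ℝ q (companionRhs g f) Ω := by
  refine contDiffOn_pi.2 fun i => ?_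
  unfold companionRhs
  split_ifs
  · exact hf.div ((hg _).of_le (by exact_mod_cast le_top)) hgp
  · exact contDiffOn_const

theorem companion_mulVec_of_lt {p : ℕ} (g : Fin (p + 1) → ℝ × ℝ → ℝ) (f : ℝ × ℝ → ℝ)
    (z : ℝ × ℝ) (y : Fin p → ℝ) (i : Fin p) (hi : (i : ℕ) + 1 < p) :
    (companion g z *ᵥ y + companionRhs g f z) i = y ⟨i + 1, hi⟩ := by
  have h1 : (companion g z *ᵥ y) i = ∑ j, companion g z i j * y j := rfl
  rw [Pi.add_apply, h1, Finset.sum_eq_single ⟨i + 1, hi⟩]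
  · simp [companion, companionRhs, hi.ne]
  · intro j _ hj
    have : (j : ℕ) ≠ i + 1 := fun h => hj (Fin.ext h)
    simp [companion, hi.ne, this]
  · simp

theorem IsScalarDistrSolution.isDistrSolution {p : ℕ} {g : Fin (p + 1) → ℝ × ℝ → ℝ}
    {hg : ∀ k, ContDiffOn ℝ ∞ (g k) Ω} {f : ℝ × ℝ → ℝ} {u : 𝓓'(Ω, ℝ)}
    (hu : IsScalarDistrSolution hg f u) (hgp : ∀ z ∈ Ω, g (Fin.last p) z ≠ 0)
    (hf : ContinuousOn f Ω) :
    IsDistrSolution (contDiffOn_companion hg hgp) (companionRhs g f)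
      fun i => xDerivDistr^[(i : ℕ)] u := by
  intro i
  have hrhs : ContinuousOn (companionRhs g f) Ω :=
    (contDiffOn_companionRhs (q := 0) hg hgp (contDiffOn_zero.2 hf)).continuousOn
  rw [← Function.iterate_succ_apply' xDerivDistr]
  refine distr_ext fun η hη => ?_
  rw [evalAt_distr_add, evalAt_distr_sum, evalAt_regularDistr
    (((continuousOn_pi.1 hrhs) i).locallyIntegrableOn Ω.isOpen.measurableSet) hη]
  simp only [evalAt_mulDistr _ _ hη]
  rcases (Nat.succ_le_of_lt i.isLt).eq_or_lt with hi | hi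
  · have hi' : (i : ℕ) + 1 = p := hi
    simp only [companion, companionRhs, hi', if_true]
    rw [show ((i : ℕ).succ) = p from hi]
    exact hu.evalAt_iterate hgp hf hη
  · have hi' : (i : ℕ) + 1 ≠ p := hi.ne
    rw [Finset.sum_eq_single ⟨i + 1, hi⟩]
    · simp [companion, companionRhs, hi']
    · intro j _ hj
      have : (j : ℕ) ≠ i + 1 := fun h => hj (Fin.ext h)
      simp only [companion, hi', this, if_false, mul_zero]
      exact evalAt_zero _
    · simp

/-- A semiregular solution of a scalar equation is given by a classical solution. -/
theorem IsScalarDistrSolution.exists_classical {q : ℕ∞} {p : ℕ} {g : Fin (p + 1) → ℝ × ℝ → ℝ}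
    {hg : ∀ k, ContDiffOn ℝ ∞ (g k) Ω} {f : ℝ × ℝ → ℝ} {u : 𝓓'(Ω, ℝ)}
    (hu : IsScalarDistrSolution hg f u) (hgp : ∀ z ∈ Ω, g (Fin.last p) z ≠ 0)
    (hf : ContDiffOn ℝ q f Ω) (hsr : IsSemiregular q u) :
    ∃ ψ : ℝ × ℝ → ℝ, IsScalarClassicalSolution Ω g f ψ ∧ ContDiffOn ℝ q ψ Ω ∧
      u = regularDistr Ω ψ := by
  obtain ⟨ψ, hψ, hd, hrep⟩ := (hu.isDistrSolution hgp hf.continuousOn).exists_classical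
    (contDiffOn_companionRhs hg hgp hf) fun i => hsr.iterate_xDerivDistr i
  -- The value which the equation prescribes for the `p`-th derivative.
  set top : ℝ × ℝ → ℝ := fun z =>
    ∑ j : Fin p, -(g j.castSucc z / g (Fin.last p) z) * ψ z j + f z / g (Fin.last p) z with htop
  have htopq : ContDiffOn ℝ q top Ω := by
    have hle : (q : ℕ∞ω) ≤ ∞ := by exact_mod_cast le_top
    refine (ContDiffOn.sum fun j _ => ContDiffOn.mul ?_ ((contDiffOn_pi.1 hψ) j)).add
      (hf.div ((hg _).of_le hle) hgp)
    exact (((hg _).div (hg _) hgp).neg).of_le hle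
  -- The chain of successive `x`-derivatives; only indices up to `p` matter.
  set φ : ℕ → ℝ × ℝ → ℝ := fun k z => if h : k < p then ψ z ⟨k, h⟩ else top z with hφ
  have hφq : ∀ k, ContDiffOn ℝ q (φ k) Ω := fun k => by
    by_cases hk : k < p
    · simpa only [hφ, hk, dite_true] using (contDiffOn_pi.1 hψ) ⟨k, hk⟩
    · simpa only [hφ, hk, dite_false] using htopq
  obtain ⟨hcx, hx⟩ := isCx_of_hasDerivAt (p := p) Ω.isOpen (φ := φ) (fun k hk z hz => by
      have h1 := hasDerivAt_pi.1 (hd z hz) ⟨k, hk⟩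
      have h2 : (companion g z *ᵥ ψ z + companionRhs g f z) ⟨k, hk⟩ = φ (k + 1) z := by
        rcases (Nat.succ_le_of_lt hk).eq_or_lt with hk' | hk'
        · have hk'' : k + 1 = p := hk'
          have h3 : (companion g z *ᵥ ψ z) ⟨k, hk⟩ = ∑ j, companion g z ⟨k, hk⟩ j * ψ z j := rfl
          rw [Pi.add_apply, h3]
          simp [companion, companionRhs, hφ, hk'', htop]
        · have hk'' : k + 1 < p := hk'
          rw [companion_mulVec_of_lt g f z (ψ z) ⟨k, hk⟩ hk']
          simp [hφ, hk'']
      rw [h2] at h1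
      simpa only [hφ, hk, dite_true] using h1)
    fun k _ => (hφq k).continuousOn
  refine ⟨φ 0, ⟨hcx, fun z hz => ?_⟩, hφq 0, ?_⟩
  · rw [Fin.sum_univ_castSucc, Fin.val_last, hx p le_rfl z hz]
    have h1 : φ p z = top z := by simp [hφ]
    have h2 : ∀ k : Fin p, xDeriv (k.castSucc : ℕ) (φ 0) z = ψ z k := fun k => by
      rw [Fin.val_castSucc, hx k k.isLt.le z hz]
      simp [hφ]
    have h3 : ∀ k : Fin p, g (Fin.last p) z * (-(g k.castSucc z / g (Fin.last p) z) * ψ z k) =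
        -(g k.castSucc z * ψ z k) := fun k => by
      have := hgp z hz
      field_simp
    rw [h1]
    simp only [h2, htop]
    rw [mul_add, Finset.mul_sum, mul_div_cancel₀ _ (hgp z hz)]
    simp only [h3, Finset.sum_neg_distrib]
    ring
  -- For `p = 0` the companion system is empty and `hrep` says nothing; there `φ 0 = top = f / g 0`,
  -- and the equation itself gives the representation.
  · rcases Nat.eq_zero_or_pos p with rfl | hp
    · refine distr_ext fun η hη => ?_
      rw [evalAt_regularDistr ((hφq 0).continuousOn.locallyIntegrableOn Ω.isOpen.measurableSet) hη]
      have h1 := hu.evalAt_iterate hgp hf.continuousOn hη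
      simpa [hφ, htop] using h1
    · have h1 := hrep ⟨0, hp⟩
      simpa only [hφ, hp, dite_true, Function.iterate_zero, id_eq] using h1

end Scalar

end ParamODE

/-! ### The theorem for continuous and for smooth data. -/

theorem mainTheorem12 (Ω : Opens (ℝ × ℝ)) (hΩ : ParamODE.IsXSimple (Ω : Set (ℝ × ℝ))) :
    -- systems `v_x = A v + F`
    (∀ (p : ℕ) (A : ℝ × ℝ → Matrix (Fin p) (Fin p) ℝ)
        (hA : ∀ i j, ContDiffOn ℝ ∞ (fun z => A z i j) Ω)
        (F : ℝ × ℝ → Fin p → ℝ) (v : Fin p → 𝓓'(Ω, ℝ)),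
      ParamODE.IsDistrSolution hA F v →
        (ContinuousOn F Ω → (∀ i, ParamODE.IsSemiregular 0 (v i)) →
          ∃ ψ : ℝ × ℝ → Fin p → ℝ, ParamODE.IsClassicalSolution Ω A F ψ ∧
            ∀ i, v i = ParamODE.regularDistr Ω (fun z => ψ z i)) ∧
        (ContDiffOn ℝ ∞ F Ω → (∀ i, ParamODE.IsSemiregular ⊤ (v i)) →
          ∃ ψ : ℝ × ℝ → Fin p → ℝ, ParamODE.IsClassicalSolution Ω A F ψ ∧
            ContDiffOn ℝ ∞ ψ Ω ∧ ∀ i, v i = ParamODE.regularDistr Ω (fun z => ψ z i))) ∧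
    -- scalar equations `∑_{k ≤ p} g_k ∂_x^k u = f` with nonvanishing leading coefficient
    (∀ (p : ℕ) (g : Fin (p + 1) → ℝ × ℝ → ℝ) (hg : ∀ k, ContDiffOn ℝ ∞ (g k) Ω)
        (f : ℝ × ℝ → ℝ) (u : 𝓓'(Ω, ℝ)),
      (∀ z ∈ Ω, g (Fin.last p) z ≠ 0) → ParamODE.IsScalarDistrSolution hg f u →
        (ContinuousOn f Ω → ParamODE.IsSemiregular 0 u →
          ∃ ψ : ℝ × ℝ → ℝ, ParamODE.IsScalarClassicalSolution Ω g f ψ ∧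
            u = ParamODE.regularDistr Ω ψ) ∧
        (ContDiffOn ℝ ∞ f Ω → ParamODE.IsSemiregular ⊤ u →
          ∃ ψ : ℝ × ℝ → ℝ, ParamODE.IsScalarClassicalSolution Ω g f ψ ∧
            ContDiffOn ℝ ∞ ψ Ω ∧ u = ParamODE.regularDistr Ω ψ)) := by
  refine ⟨fun p A hA F v hv => ?_, fun p g hg f u hgp hu => ?_⟩
  · have hA' : ∀ i j, ContinuousOn (fun z => A z i j) Ω := fun i j => (hA i j).continuousOn
    refine ⟨fun hF hsr => ?_, fun hF hsr => ?_⟩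
    · obtain ⟨ψ, hψ, hd, hrep⟩ := hv.exists_classical (q := 0) (contDiffOn_zero.2 hF) hsr
      exact ⟨ψ, ParamODE.isClassicalSolution_of_hasDerivAt Ω.isOpen hA' hF hψ.continuousOn hd,
        hrep⟩
    · obtain ⟨ψ, hψ, hd, hrep⟩ := hv.exists_classical (q := ⊤) hF hsr
      exact ⟨ψ, ParamODE.isClassicalSolution_of_hasDerivAt Ω.isOpen hA' hF.continuousOn
        hψ.continuousOn hd, hψ, hrep⟩
  · refine ⟨fun hf hsr => ?_, fun hf hsr => hu.exists_classical (q := ⊤) hgp hf hsr⟩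
    obtain ⟨ψ, hψ, -, hrep⟩ := hu.exists_classical (q := 0) hgp (contDiffOn_zero.2 hf) hsr
    exact ⟨ψ, hψ, hrep⟩
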